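/- Let $\mathcal X,\mathcal Y$ be finite alphabets, $\check p$ a probability mass function on $\mathcal X$, and $q(y|x)$ a channel from $\mathcal X$ to $\mathcal Y$. All information quantities are in bits. For $R_1,R_2\ge 0$ and $n\ge 1$, a $(2^{nR_1},2^{nR_2},n)$ channel simulation code consists of a randomized encoder $p(i|x^n,j)$ and a randomized decoder $p(y^n|i,j)$, where $i\in\{1,\dots,\lfloor 2^{nR_1}\rfloor\}$ and $j\in\{1,\dots,\lfloor 2^{nR_2}\rfloor\}$. With $X^n$ i.i.d. $\sim\check p$ and $J$ uniform on $\{1,\dots,\lfloor 2^{nR_2}\rfloor\}$ and independent of $X^n$, it induces the joint distribution $$p(x^n,y^n,i,j)=\frac{1}{\lfloor 2^{nR_2}\rfloor}\prod_{k=1}^n\check p(x_k)\;p(i|x^n,j)\,p(y^n|i,j).$$ The pair $(R_1,R_2)$ is achievable if there is a sequence of such codes, $n=1,2,\dots$, whose induced marginals $p(x^n,y^n)$ satisfy $$\lim_{n\to\infty}\tfrac12\sum_{x^n,y^n}\Big|p(x^n,y^n)-\prod_{k=1}^n\check p(x_k)q(y_k|x_k)\Big|=0.$$ The simulation rate region is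 the closure in $\mathbb R^2$ of the set of achievable pairs. **Theorem.** The simulation rate region equals $$S=\{(R_1,R_2)\in\mathbb R^2: R_2\ge 0,\ \exists\, p(x,y,u)\in D \text{ with } R_1\ge I(X;U)\text{ and } R_1+R_2\ge I(X,Y;U)\},$$ where $D$ is the set of joint distributions $p(x,y,u)$ on $\mathcal X\times\mathcal Y\times\mathcal U$ such that $(X,Y)\sim\check p(x)q(y|x)$, $X-U-Y$ is a Markov chain, and $|\mathcal U|\le|\mathcal X||\mathcal Y|+1$. Moreover, for $(X,Y)\sim\check p(x)q(y|x)$: 1. the least $R_1$ such that $(R_1,0)$ lies in the region is Wyner's common information $C(X;Y)=\min I(X,Y;U)$, the minimum being over all $U$ with a finite alphabet such that $X-U-Y$ is a Markov chain; 2. every $(R_1,R_2)$ in the region satisfies $R_1\ge I(X;Y)$, and for every $R_2\ge H(Y|X)$ the least $R_1$ such that $(R_1,R_2)$ lies in the region is $I(X;Y)$. -/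

import Mathlib

/-!
Probability mass functions on a finite type `α` are functions `α → ℝ` that belong to
`stdSimplex ℝ α`. All information quantities are in bits.
-/

noncomputable section

namespace ChannelSimulation

/-- Total variation distance `½ ∑ |p - q|`. -/
def tvDist {α : Type*} [Fintype α] (p q : α → ℝ) : ℝ :=
  (1 / 2) * ∑ a, |p a - q a|

/-- First marginal. -/
def fstMarginal {α β : Type*} [Fintype β] (r : α × β → ℝ) : α → ℝ :=
  fun a => ∑ b, r (a, b)

/-- Second marginal. -/
def sndMarginal {α β : Type*} [Fintype α] (r : α × β → ℝ) : β → ℝ :=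
  fun b => ∑ a, r (a, b)

/-- Mutual information `I(A;B) = ∑ r(a,b) log₂ (r(a,b) / (r(a) r(b)))` of `(A,B) ∼ r`
(terms with `r(a,b) = 0` vanish). -/
def mutualInfo {α β : Type*} [Fintype α] [Fintype β] (r : α × β → ℝ) : ℝ :=
  ∑ a, ∑ b, r (a, b) * Real.logb 2 (r (a, b) / (fstMarginal r a * sndMarginal r b))

/-- Conditional entropy `H(B|A) = -∑ r(a,b) log₂ (r(a,b) / r(a))` of `(A,B) ∼ r`. -/
def condEntropy {α β : Type*} [Fintype α] [Fintype β] (r : α × β → ℝ) : ℝ :=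
  -∑ a, ∑ b, r (a, b) * Real.logb 2 (r (a, b) / fstMarginal r a)

/-- The desired joint distribution `p̌(x) q(y|x)`. -/
def jointDist {X Y : Type*} (p : X → ℝ) (q : X → Y → ℝ) : X × Y → ℝ :=
  fun z => p z.1 * q z.1 z.2

/-- The law of `(X,U)` when `((X,Y),U) ∼ t`. -/
def margXU {X Y U : Type*} [Fintype Y] (t : (X × Y) × U → ℝ) : X × U → ℝ :=
  fun z => ∑ y, t ((z.1, y), z.2)

/-- The law of `(Y,U)` when `((X,Y),U) ∼ t`. -/
def margYU {X Y U : Type*} [Fintype X] (t : (X × Y) × U → ℝ) : Y × U → ℝ :=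
  fun z => ∑ x, t ((x, z.1), z.2)

/-- `X - U - Y` is a Markov chain: `p(x,y,u) p(u) = p(x,u) p(y,u)`. -/
def IsMarkov {X Y U : Type*} [Fintype X] [Fintype Y] (t : (X × Y) × U → ℝ) : Prop :=
  ∀ x y u, t ((x, y), u) * sndMarginal t u = margXU t (x, u) * margYU t (y, u)

/-- The joint distributions `p(x,y,u)`, with `u` in the alphabet `U`, such that `(X,Y) ∼ r` and
`X - U - Y` is a Markov chain. -/
def auxDists {X Y : Type*} [Fintype X] [Fintype Y] (r : X × Y → ℝ) (U : Type*) [Fintype U] :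
    Set ((X × Y) × U → ℝ) :=
  {t | t ∈ stdSimplex ℝ ((X × Y) × U) ∧ fstMarginal t = r ∧ IsMarkov t}

/-- Wyner's common information `C(X;Y)`, the minimum of `I(X,Y;U)` over all `X - U - Y` with
`(X,Y) ∼ r` and `U` in an arbitrary finite alphabet. -/
def commonInfo {X Y : Type*} [Fintype X] [Fintype Y] (r : X × Y → ℝ) : ℝ :=
  sInf {c | ∃ (m : ℕ) (t : (X × Y) × Fin m → ℝ), t ∈ auxDists r (Fin m) ∧ c = mutualInfo t}

/-- A channel simulation code of block length `n` with `M` messages and a common random index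
with `N` values: a randomized encoder `p(i | xⁿ, j)` and a randomized decoder `p(yⁿ | i, j)`. -/
structure Code (X Y : Type*) [Fintype X] [Fintype Y] (n M N : ℕ) where
  /-- `enc x j i = p(i | xⁿ = x, j)` -/
  enc : (Fin n → X) → Fin N → Fin M → ℝ
  /-- `dec i j y = p(yⁿ = y | i, j)` -/
  dec : Fin M → Fin N → (Fin n → Y) → ℝ
  enc_mem : ∀ x j, enc x j ∈ stdSimplex ℝ (Fin M)
  dec_mem : ∀ i j, dec i j ∈ stdSimplex ℝ (Fin n → Y)

/-- The induced joint distribution of `(Xⁿ, Yⁿ, I, J)`, where `Xⁿ` is i.i.d. `∼ p` and `J` is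
uniform and independent of `Xⁿ`. -/
def Code.induced {X Y : Type*} [Fintype X] [Fintype Y] {n M N : ℕ} (c : Code X Y n M N)
    (p : X → ℝ) (x : Fin n → X) (y : Fin n → Y) (i : Fin M) (j : Fin N) : ℝ :=
  (1 / (N : ℝ)) * (∏ k, p (x k)) * c.enc x j i * c.dec i j y

/-- The marginal of `(Xⁿ, Yⁿ)` in the induced joint distribution. -/
def Code.inducedXY {X Y : Type*} [Fintype X] [Fintype Y] {n M N : ℕ} (c : Code X Y n M N)
    (p : X → ℝ) : (Fin n → X) × (Fin n → Y) → ℝ :=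
  fun z => ∑ i, ∑ j, c.induced p z.1 z.2 i j

/-- The i.i.d. distribution `∏ p̌(x_k) q(y_k|x_k)`. -/
def iidDist {X Y : Type*} (p : X → ℝ) (q : X → Y → ℝ) (n : ℕ) :
    (Fin n → X) × (Fin n → Y) → ℝ :=
  fun z => ∏ k, jointDist p q (z.1 k, z.2 k)

/-- The number of elements of `{1, …, 2^{nR}}`. -/
def indexCount (n : ℕ) (R : ℝ) : ℕ := ⌊(2 : ℝ) ^ ((n : ℝ) * R)⌋₊

/-- `R = (R₁, R₂)` is achievable: the rates are nonnegative, and some sequence of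
`(2^{nR₁}, 2^{nR₂}, n)` codes simulates the channel with vanishing total variation. -/
def Achievable {X Y : Type*} [Fintype X] [Fintype Y] (p : X → ℝ) (q : X → Y → ℝ)
    (R : ℝ × ℝ) : Prop :=
  0 ≤ R.1 ∧ 0 ≤ R.2 ∧
    ∃ c : ∀ n : ℕ, Code X Y n (indexCount n R.1) (indexCount n R.2),
      Filter.Tendsto (fun n => tvDist ((c n).inducedXY p) (iidDist p q n))
        Filter.atTop (nhds 0)

/-- The simulation rate region: the closure of the set of achievable rate pairs. -/
def simulationRateRegion {X Y : Type*} [Fintype X] [Fintype Y] (p : X → ℝ) (q : X → Y → ℝ) :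
    Set (ℝ × ℝ) :=
  closure {R | Achievable p q R}

/-- The set `S` of rate pairs (`R₁ ≥ 0` follows from `R₁ ≥ I(X;U)`). -/
def rateSet {X Y : Type*} [Fintype X] [Fintype Y] (p : X → ℝ) (q : X → Y → ℝ) :
    Set (ℝ × ℝ) :=
  {R | 0 ≤ R.2 ∧ ∃ m : ℕ, m ≤ Fintype.card X * Fintype.card Y + 1 ∧
    ∃ t ∈ auxDists (jointDist p q) (Fin m),
      mutualInfo (margXU t) ≤ R.1 ∧ mutualInfo t ≤ R.1 + R.2}

end ChannelSimulation

end

/-! Converse. Put `W = (I, J)`. Given `W`, the blocks `Xⁿ` and `Yⁿ` are independent; `I(Xⁿ;W) ≤ log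
M` because `J` is independent of `Xⁿ`, and `I(Xⁿ,Yⁿ;W) ≤ log (M N)`. A uniform time index `K` and
subadditivity of entropy turn these into single-letter bounds with `U = (W, K)`
(`exists_auxDists_of_code`). The pair law obtained is only close to the target, and entropy
continuity in total variation (`ent_le_ent_add_tvDist`) controls the loss. Since the alphabet of `U`
grows with `n`, it is cut down to `|X||Y| + 1` symbols (`exists_auxDists_card_le`) before a
compactness argument (`exists_auxDists_of_tendsto`) yields a limit with the exact pair law.

Achievability. Draw `M N` codewords i.i.d. from `Qⁿ`. By soft covering
(`exists_softCovering_bound`), the whole codebook reproduces `(X,Y)ⁿ` when `R₁ + R₂ > I(X,Y;U)`, and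
each slice of fixed `j` reproduces `Xⁿ` when `R₁ > I(X;U)`. The encoder samples `i` from its
posterior given `(xⁿ, j)`, the decoder passes the codeword through `p(y|u)`, and the two covering
errors bound the simulation error (`exists_code_of_codebook`).

Extreme points. If `R₂ = 0`, the constraint on `I(X;U)` follows from the other by data processing,
which leaves Wyner's quantity. Data processing also gives `I(X;Y) ≤ I(X;U)`, with equality for `U =
Y`, where `I(X,Y;U) = H(Y) = I(X;Y) + H(Y|X)`. -/

noncomputable section

namespace ChannelSimulation

open Real Finset

/-! ### Entropy and mutual information -/

/-- Shannon entropy in nats. -/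
def ent {α : Type*} [Fintype α] (p : α → ℝ) : ℝ := ∑ a, negMulLog (p a)

lemma ent_eq_neg_sum {α : Type*} [Fintype α] (p : α → ℝ) :
    ent p = -∑ a, p a * log (p a) := by
  simp [ent, negMulLog]

lemma continuous_ent {α : Type*} [Fintype α] : Continuous (ent : (α → ℝ) → ℝ) := by
  unfold ent
  fun_prop

lemma log_two_pos : (0 : ℝ) < log 2 := log_pos one_lt_two

/-- Gibbs' inequality, from `log x ≤ x - 1`. Maximality of the uniform law, subadditivity, data
processing and `I ≥ 0` all come from it by a choice of `Q`, which need not be normalized. -/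
lemma sum_mul_log_sub_log_nonneg {α : Type*} [Fintype α] {P Q : α → ℝ} (hP : ∀ a, 0 ≤ P a)
    (hQ : ∀ a, 0 ≤ Q a) (hPQ : ∀ a, Q a = 0 → P a = 0) (hsum : ∑ a, Q a ≤ ∑ a, P a) :
    0 ≤ ∑ a, P a * (log (P a) - log (Q a)) := by
  have key : ∀ a, P a - Q a ≤ P a * (log (P a) - log (Q a)) := by
    intro a
    rcases (hP a).eq_or_lt with h | h
    · simp [← h, hQ a]
    · have hq : 0 < Q a := lt_of_le_of_ne (hQ a) fun h' => h.ne' (hPQ a h'.symm)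
      have h1 := log_le_sub_one_of_pos (div_pos hq h)
      rw [log_div hq.ne' h.ne'] at h1
      have h2 := mul_le_mul_of_nonneg_left h1 h.le
      have h3 : P a * (Q a / P a - 1) = Q a - P a := by field_simp
      linarith
  calc (0 : ℝ) ≤ ∑ a, (P a - Q a) := by rw [sum_sub_distrib]; linarith
    _ ≤ _ := sum_le_sum fun a _ => key a

/-- Gibbs against the constant weight of the same mass. The mass is left free because `d` will be
the positive part of a difference of two laws. -/
lemma sum_negMulLog_le {α : Type*} [Fintype α] {d : α → ℝ} (hd : ∀ a, 0 ≤ d a) :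
    ∑ a, negMulLog (d a) ≤ (∑ a, d a) * log (Fintype.card α) + negMulLog (∑ a, d a) := by
  rcases (sum_nonneg fun a (_ : a ∈ univ) => hd a).eq_or_lt with h | h
  · have h0 : ∀ a, d a = 0 := fun a =>
      (sum_eq_zero_iff_of_nonneg fun a _ => hd a).1 h.symm a (mem_univ a)
    simp [h0]
  · have hne : Nonempty α := by
      by_contra hc
      rw [not_nonempty_iff] at hc
      simp at h
    have hc : (0 : ℝ) < Fintype.card α := by exact_mod_cast Fintype.card_pos
    have hg := sum_mul_log_sub_log_nonneg (P := d) (Q := fun _ => (∑ a, d a) / Fintype.card α) hd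
      (fun _ => by positivity) (fun a h' => absurd h' (by positivity))
      (by simp only [sum_const, card_univ, nsmul_eq_mul]; rw [mul_div_cancel₀ _ hc.ne'])
    simp only [mul_sub, sum_sub_distrib, ← sum_mul, log_div h.ne' hc.ne'] at hg
    simp only [negMulLog, neg_mul, sum_neg_distrib]
    linarith

lemma ent_le_log_card {α : Type*} [Fintype α] {p : α → ℝ} (hp : p ∈ stdSimplex ℝ α) :
    ent p ≤ log (Fintype.card α) := by
  have := sum_negMulLog_le hp.1
  simpa [hp.2, ent] using this

lemma fstMarginal_nonneg {α β : Type*} [Fintype β] {r : α × β → ℝ} (hr : ∀ z, 0 ≤ r z) (a : α) :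
    0 ≤ fstMarginal r a := sum_nonneg fun _ _ => hr _

lemma sndMarginal_nonneg {α β : Type*} [Fintype α] {r : α × β → ℝ} (hr : ∀ z, 0 ≤ r z) (b : β) :
    0 ≤ sndMarginal r b := sum_nonneg fun _ _ => hr _

lemma le_fstMarginal {α β : Type*} [Fintype β] {r : α × β → ℝ} (hr : ∀ z, 0 ≤ r z) (a : α)
    (b : β) : r (a, b) ≤ fstMarginal r a :=
  single_le_sum (f := fun b => r (a, b)) (fun _ _ => hr _) (mem_univ b)

lemma le_sndMarginal {α β : Type*} [Fintype α] {r : α × β → ℝ} (hr : ∀ z, 0 ≤ r z) (a : α)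
    (b : β) : r (a, b) ≤ sndMarginal r b :=
  single_le_sum (f := fun a => r (a, b)) (fun _ _ => hr _) (mem_univ a)

lemma sum_fstMarginal {α β : Type*} [Fintype α] [Fintype β] (r : α × β → ℝ) :
    ∑ a, fstMarginal r a = ∑ z, r z := (Fintype.sum_prod_type _).symm

lemma sum_sndMarginal {α β : Type*} [Fintype α] [Fintype β] (r : α × β → ℝ) :
    ∑ b, sndMarginal r b = ∑ z, r z := (Fintype.sum_prod_type_right _).symm

lemma fstMarginal_mem {α β : Type*} [Fintype α] [Fintype β] {r : α × β → ℝ}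
    (hr : r ∈ stdSimplex ℝ (α × β)) : fstMarginal r ∈ stdSimplex ℝ α :=
  ⟨fstMarginal_nonneg hr.1, by rw [sum_fstMarginal, hr.2]⟩

lemma sndMarginal_mem {α β : Type*} [Fintype α] [Fintype β] {r : α × β → ℝ}
    (hr : r ∈ stdSimplex ℝ (α × β)) : sndMarginal r ∈ stdSimplex ℝ β :=
  ⟨sndMarginal_nonneg hr.1, by rw [sum_sndMarginal, hr.2]⟩

lemma mutualInfo_mul_log_two {α β : Type*} [Fintype α] [Fintype β] {r : α × β → ℝ}
    (hr : ∀ z, 0 ≤ r z) :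
    mutualInfo r * log 2 =
      ∑ z, r z * (log (r z) - log (fstMarginal r z.1) - log (sndMarginal r z.2)) := by
  rw [Fintype.sum_prod_type, mutualInfo, sum_mul]
  refine sum_congr rfl fun a _ => ?_
  rw [sum_mul]
  refine sum_congr rfl fun b _ => ?_
  rcases (hr (a, b)).eq_or_lt with h | h
  · simp [← h]
  · have h1 := h.trans_le (le_fstMarginal hr a b)
    have h2 := h.trans_le (le_sndMarginal hr a b)
    rw [logb, log_div h.ne' (mul_pos h1 h2).ne', log_mul h1.ne' h2.ne']
    field_simp [log_two_pos.ne']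
    ring

lemma mutualInfo_mul_log_two_eq_ent {α β : Type*} [Fintype α] [Fintype β] {r : α × β → ℝ}
    (hr : ∀ z, 0 ≤ r z) :
    mutualInfo r * log 2 = ent (fstMarginal r) + ent (sndMarginal r) - ent r := by
  rw [mutualInfo_mul_log_two hr]
  simp only [mul_sub, sum_sub_distrib, ent_eq_neg_sum]
  have h1 : ∑ z, r z * log (fstMarginal r z.1) = ∑ a, fstMarginal r a * log (fstMarginal r a) := by
    rw [Fintype.sum_prod_type]
    exact sum_congr rfl fun a _ => by simp only [fstMarginal, sum_mul]
  have h2 : ∑ z, r z * log (sndMarginal r z.2) = ∑ a, sndMarginal r a * log (sndMarginal r a) := by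
    rw [Fintype.sum_prod_type_right]
    exact sum_congr rfl fun a _ => by simp only [sndMarginal, sum_mul]
  rw [h1, h2]; ring

/-- The joint law of `(Z, U)` when `U ∼ Q` and `Z ∼ K u` given `U = u`. -/
def compLaw {Z U : Type*} (Q : U → ℝ) (K : U → Z → ℝ) : Z × U → ℝ :=
  fun z => Q z.2 * K z.2 z.1

section compLaw

variable {Z U : Type*} [Fintype Z] {Q : U → ℝ} {K : U → Z → ℝ}

lemma compLaw_nonneg (hQ : ∀ u, 0 ≤ Q u) (hK : ∀ u, K u ∈ stdSimplex ℝ Z) (z : Z × U) :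
    0 ≤ compLaw Q K z := mul_nonneg (hQ _) ((hK _).1 _)

lemma sndMarginal_compLaw (hK : ∀ u, K u ∈ stdSimplex ℝ Z) :
    sndMarginal (compLaw Q K) = Q := by
  funext u
  simp [sndMarginal, compLaw, ← mul_sum, (hK u).2]

lemma compLaw_mem [Fintype U] (hQ : Q ∈ stdSimplex ℝ U) (hK : ∀ u, K u ∈ stdSimplex ℝ Z) :
    compLaw Q K ∈ stdSimplex ℝ (Z × U) :=
  ⟨compLaw_nonneg hQ.1 hK, by rw [← sum_sndMarginal, sndMarginal_compLaw hK, hQ.2]⟩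

lemma mutualInfo_compLaw [Fintype U] (hQ : ∀ u, 0 ≤ Q u) (hK : ∀ u, K u ∈ stdSimplex ℝ Z) :
    mutualInfo (compLaw Q K) * log 2 =
      ent (fstMarginal (compLaw Q K)) - ∑ u, Q u * ent (K u) := by
  rw [mutualInfo_mul_log_two_eq_ent (compLaw_nonneg hQ hK), sndMarginal_compLaw hK]
  have : ent (compLaw Q K) = ent Q + ∑ u, Q u * ent (K u) := by
    unfold ent compLaw
    rw [Fintype.sum_prod_type_right, ← sum_add_distrib]
    refine sum_congr rfl fun u _ => ?_
    simp only [negMulLog_mul, sum_add_distrib, ← sum_mul, ← mul_sum, (hK u).2, one_mul]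
  rw [this]; ring

end compLaw

/-- `I(Z;W) ≤ log (c |W|)` when all conditional probabilities `r(w|z)` are at most `c`. -/
lemma mutualInfo_le_log_card {Z W : Type*} [Fintype Z] [Fintype W] {r : Z × W → ℝ}
    (hr : r ∈ stdSimplex ℝ (Z × W)) {c : ℝ} (hc : 0 < c)
    (h : ∀ z w, r (z, w) ≤ c * fstMarginal r z) :
    mutualInfo r * log 2 ≤ log c + log (Fintype.card W) := by
  rw [mutualInfo_mul_log_two hr.1]
  calc _ ≤ ∑ z, r z * (log c - log (sndMarginal r z.2)) := by
        refine sum_le_sum fun z _ => ?_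
        rcases (hr.1 z).eq_or_lt with h0 | h0
        · simp [← h0]
        · have h1 := h0.trans_le (le_fstMarginal hr.1 z.1 z.2)
          have := log_le_log h0 (h z.1 z.2)
          rw [log_mul hc.ne' h1.ne'] at this
          exact mul_le_mul_of_nonneg_left (by linarith) h0.le
    _ = log c + ent (sndMarginal r) := by
        simp only [mul_sub, sum_sub_distrib, ent_eq_neg_sum, ← sum_mul, hr.2]
        rw [Fintype.sum_prod_type_right, one_mul, sub_eq_add_neg]
        congr 2
        exact sum_congr rfl fun a _ => by simp only [sndMarginal, sum_mul]
    _ ≤ _ := by gcongr; exact ent_le_log_card (sndMarginal_mem hr)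

/-! ### Continuity of entropy in total variation -/

/-- If `s ≥ t`, this is subadditivity of `-x log x`. If `s < t`, then `t log t - s log s = s log
(t/s) + (t - s) log t`, where the first term is at most `t - s` and the second is nonpositive. -/
lemma negMulLog_le_add {s t : ℝ} (hs : 0 ≤ s) (ht : 0 ≤ t) (ht1 : t ≤ 1) :
    negMulLog s ≤ negMulLog t + negMulLog (max (s - t) 0) + max (t - s) 0 := by
  rcases le_total t s with h | h
  · rw [max_eq_left (sub_nonneg.2 h), max_eq_right (sub_nonpos.2 h), add_zero]
    obtain ⟨d, rfl⟩ := exists_add_of_le h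
    have hd : 0 ≤ d := by linarith
    rw [add_sub_cancel_left]
    rcases ht.eq_or_lt with rfl | ht
    · simp
    rcases hd.eq_or_lt with rfl | hd
    · simp
    have h1 : log t ≤ log (t + d) := log_le_log ht (by linarith)
    have h2 : log d ≤ log (t + d) := log_le_log hd (by linarith)
    simp only [negMulLog]
    nlinarith
  · rw [max_eq_right (sub_nonpos.2 h), max_eq_left (sub_nonneg.2 h), negMulLog_zero, add_zero]
    rcases hs.eq_or_lt with rfl | hs
    · have := negMulLog_nonneg ht ht1
      simp; linarith
    have ht0 : 0 < t := hs.trans_le h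
    have h1 := log_le_sub_one_of_pos (div_pos ht0 hs)
    rw [log_div ht0.ne' hs.ne'] at h1
    have h2 := mul_le_mul_of_nonneg_left h1 hs.le
    have h3 : s * (t / s - 1) = t - s := by field_simp
    have h4 : log t ≤ 0 := log_nonpos ht ht1
    simp only [negMulLog]
    nlinarith

lemma tvDist_eq_sum_max {α : Type*} [Fintype α] {P Q : α → ℝ} (h : ∑ a, P a = ∑ a, Q a) :
    ∑ a, max (P a - Q a) 0 = tvDist P Q := by
  have : ∀ a, max (P a - Q a) 0 = (1 / 2) * |P a - Q a| + (1 / 2) * (P a - Q a) := by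
    intro a
    rcases le_total (P a - Q a) 0 with h | h
    · rw [max_eq_right h, abs_of_nonpos h]; ring
    · rw [max_eq_left h, abs_of_nonneg h]; ring
  simp only [this, sum_add_distrib, ← mul_sum, sum_sub_distrib, h, tvDist]
  ring

lemma tvDist_comm {α : Type*} [Fintype α] (P Q : α → ℝ) : tvDist P Q = tvDist Q P := by
  simp [tvDist, abs_sub_comm]

/-- A Fannes-type bound. The alphabet enters only through `tvDist * log |α|`, so for blocks of
length `n` the loss per letter still vanishes with the distance. -/
lemma ent_le_ent_add_tvDist {α : Type*} [Fintype α] {P Q : α → ℝ} (hP : P ∈ stdSimplex ℝ α)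
    (hQ : Q ∈ stdSimplex ℝ α) :
    ent Q ≤ ent P + (tvDist P Q * log (Fintype.card α) + negMulLog (tvDist P Q)
      + tvDist P Q) := by
  have hs : ∑ a, P a = ∑ a, Q a := by rw [hP.2, hQ.2]
  calc ent Q ≤ ∑ a, (negMulLog (P a) + negMulLog (max (Q a - P a) 0) + max (P a - Q a) 0) :=
        sum_le_sum fun a _ => negMulLog_le_add (hQ.1 a) (hP.1 a)
          (hP.2 ▸ single_le_sum (fun a _ => hP.1 a) (mem_univ a))
    _ = ent P + ∑ a, negMulLog (max (Q a - P a) 0) + tvDist P Q := by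
        rw [sum_add_distrib, sum_add_distrib, tvDist_eq_sum_max hs]; rfl
    _ ≤ _ := by
        have := sum_negMulLog_le (d := fun a => max (Q a - P a) 0) fun a => le_max_right _ _
        rw [tvDist_eq_sum_max hs.symm, tvDist_comm Q P] at this
        linarith

/-! ### Product laws -/

/-- The law of independent copies of `Q`, indexed by `ι`. -/
def iid {ι U : Type*} [Fintype ι] (Q : U → ℝ) : (ι → U) → ℝ := fun c => ∏ i, Q (c i)

section iid

variable {ι U : Type*} [Fintype ι] [DecidableEq ι] [Fintype U]

lemma sum_prod_apply (F : ι → U → ℝ) : ∑ c : ι → U, ∏ i, F i (c i) = ∏ i, ∑ u, F i u :=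
  (Fintype.prod_sum F).symm

lemma iid_mem {Q : U → ℝ} (hQ : Q ∈ stdSimplex ℝ U) : iid Q ∈ stdSimplex ℝ (ι → U) :=
  ⟨fun c => prod_nonneg fun i _ => hQ.1 (c i), by
    simp only [iid]
    rw [sum_prod_apply (fun _ => Q)]
    simp [hQ.2]⟩

lemma sum_iid_mul_apply {Q : U → ℝ} (hQ : Q ∈ stdSimplex ℝ U) (g : U → ℝ) (j : ι) :
    ∑ c : ι → U, iid Q c * g (c j) = ∑ u, Q u * g u := by
  have : ∀ c : ι → U, iid Q c * g (c j) = ∏ i, Q (c i) * if i = j then g (c i) else 1 := by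
    intro c
    rw [prod_mul_distrib, prod_ite_eq' univ j, if_pos (mem_univ j), iid]
  simp only [this]
  rw [sum_prod_apply (fun i u => Q u * if i = j then g u else 1), ← mul_prod_erase _ _ (mem_univ j),
    prod_eq_one]
  · simp
  · intro i hi
    simp [ne_of_mem_erase hi, hQ.2]

lemma sum_iid_mul_apply_mul_apply {Q : U → ℝ} (hQ : Q ∈ stdSimplex ℝ U) (g h : U → ℝ) {j k : ι}
    (hjk : j ≠ k) :
    ∑ c : ι → U, iid Q c * (g (c j) * h (c k)) = (∑ u, Q u * g u) * ∑ u, Q u * h u := by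
  have : ∀ c : ι → U, iid Q c * (g (c j) * h (c k)) =
      ∏ i, Q (c i) * ((if i = j then g (c i) else 1) * if i = k then h (c i) else 1) := by
    intro c
    rw [prod_mul_distrib, prod_mul_distrib, prod_ite_eq' univ j, if_pos (mem_univ j),
      prod_ite_eq' univ k, if_pos (mem_univ k), iid]
  simp only [this]
  rw [sum_prod_apply
      (fun i u => Q u * ((if i = j then g u else 1) * if i = k then h u else 1)),
    ← mul_prod_erase _ _ (mem_univ j), ← mul_prod_erase _ _ (mem_erase.2 ⟨hjk.symm, mem_univ k⟩),
    prod_eq_one]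
  · simp [hjk, hjk.symm]
  · intro i hi
    have h1 := ne_of_mem_erase hi
    have h2 := ne_of_mem_erase (mem_of_mem_erase hi)
    simp [h1, h2, hQ.2]

open Classical in
/-- The law of the coordinate `k` of a random vector with law `P`. -/
def coordMarg (k : ι) (P : (ι → U) → ℝ) : U → ℝ := fun u => ∑ c, if c k = u then P c else 0

lemma sum_coordMarg_mul (k : ι) (P : (ι → U) → ℝ) (g : U → ℝ) :
    ∑ u, coordMarg k P u * g u = ∑ c, P c * g (c k) := by
  classical
  simp only [coordMarg, sum_mul, ite_mul, zero_mul]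
  rw [sum_comm]
  simp

lemma coordMarg_mem (k : ι) {P : (ι → U) → ℝ} (hP : P ∈ stdSimplex ℝ (ι → U)) :
    coordMarg k P ∈ stdSimplex ℝ U := by
  refine ⟨fun u => sum_nonneg fun c _ => ?_, ?_⟩
  · split_ifs
    exacts [hP.1 c, le_rfl]
  · have := sum_coordMarg_mul k P fun _ => 1
    simpa [hP.2] using this

lemma le_coordMarg (k : ι) {P : (ι → U) → ℝ} (hP : ∀ c, 0 ≤ P c) (c : ι → U) :
    P c ≤ coordMarg k P (c k) := by
  classical
  have := single_le_sum (f := fun c' : ι → U => if c' k = c k then P c' else 0) (s := univ)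
    (fun c' _ => by split_ifs; exacts [hP c', le_rfl]) (mem_univ c)
  simpa [coordMarg] using this

lemma coordMarg_iid {Q : U → ℝ} (hQ : Q ∈ stdSimplex ℝ U) (k : ι) : coordMarg k (iid Q) = Q := by
  classical
  funext u
  have := sum_iid_mul_apply hQ (fun v => if v = u then 1 else 0) k
  simpa [coordMarg] using this

lemma sum_abs_coordMarg_sub_le (k : ι) (P Q : (ι → U) → ℝ) :
    ∑ u, |coordMarg k P u - coordMarg k Q u| ≤ ∑ c, |P c - Q c| := by
  classical
  calc _ ≤ ∑ u, ∑ c : ι → U, (if c k = u then |P c - Q c| else 0) := by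
        refine sum_le_sum fun u _ => ?_
        rw [coordMarg, coordMarg, ← sum_sub_distrib]
        refine (abs_sum_le_sum_abs _ _).trans (sum_le_sum fun c _ => ?_)
        split_ifs <;> simp
    _ = _ := by rw [sum_comm]; simp

/-- Subadditivity of entropy. -/
lemma ent_le_sum_ent_coordMarg {P : (ι → U) → ℝ} (hP : P ∈ stdSimplex ℝ (ι → U)) :
    ent P ≤ ∑ k, ent (coordMarg k P) := by
  have hg := sum_mul_log_sub_log_nonneg (P := P) (Q := fun c => ∏ k, coordMarg k P (c k)) hP.1
    (fun c => prod_nonneg fun k _ => (coordMarg_mem k hP).1 _) (fun c hc => by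
      obtain ⟨k, -, hk⟩ := prod_eq_zero_iff.1 hc
      exact le_antisymm (hk ▸ le_coordMarg k hP.1 c) (hP.1 c)) (by
      rw [sum_prod_apply (fun k => coordMarg k P), hP.2]
      simp [(coordMarg_mem _ hP).2])
  have h2 : ∑ c, P c * log (∏ k, coordMarg k P (c k)) =
      ∑ k, ∑ u, coordMarg k P u * log (coordMarg k P u) := by
    simp only [fun k => sum_coordMarg_mul k P fun u => log (coordMarg k P u)]
    rw [sum_comm]
    refine sum_congr rfl fun c _ => ?_
    rcases (hP.1 c).eq_or_lt with h | h
    · simp [← h]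
    · rw [log_prod fun k _ => (h.trans_le (le_coordMarg k hP.1 c)).ne', mul_sum]
  simp only [mul_sub, sum_sub_distrib, h2] at hg
  simp only [ent_eq_neg_sum, sum_neg_distrib]
  linarith

lemma ent_iid {Q : U → ℝ} (hQ : Q ∈ stdSimplex ℝ U) :
    ent (iid Q : (ι → U) → ℝ) = Fintype.card ι * ent Q := by
  have h2 : ∑ c : ι → U, iid Q c * log (iid Q c) = ∑ k : ι, ∑ u, Q u * log (Q u) := by
    rw [sum_congr rfl fun (k : ι) _ => (sum_iid_mul_apply hQ (fun u => log (Q u)) k).symm,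
      sum_comm]
    refine sum_congr rfl fun c _ => ?_
    by_cases h : iid Q c = 0
    · simp [h]
    · rw [← mul_sum]
      congr 1
      rw [iid, log_prod fun k _ => prod_ne_zero_iff.1 h k (mem_univ k)]
  rw [ent_eq_neg_sum, h2, ent_eq_neg_sum]
  simp

end iid

/-! ### Auxiliary variables and their factored form -/

/-- The product law `a ⊗ b`. -/
def prodLaw {X Y : Type*} (a : X → ℝ) (b : Y → ℝ) : X × Y → ℝ := fun z => a z.1 * b z.2

/-- The joint law `Q(u) A(x|u) B(y|u)`. -/
def auxLaw {X Y U : Type*} (Q : U → ℝ) (A : U → X → ℝ) (B : U → Y → ℝ) : (X × Y) × U → ℝ :=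
  compLaw Q fun u => prodLaw (A u) (B u)

section structural

variable {X Y U : Type*}

lemma prodLaw_mem [Fintype X] [Fintype Y] {a : X → ℝ} {b : Y → ℝ}
    (ha : a ∈ stdSimplex ℝ X) (hb : b ∈ stdSimplex ℝ Y) :
    prodLaw a b ∈ stdSimplex ℝ (X × Y) := by
  refine ⟨fun z => mul_nonneg (ha.1 _) (hb.1 _), ?_⟩
  simp only [prodLaw, Fintype.sum_prod_type, ← mul_sum, hb.2, mul_one, ha.2]

lemma ent_prodLaw [Fintype X] [Fintype Y] {a : X → ℝ} {b : Y → ℝ}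
    (ha : a ∈ stdSimplex ℝ X) (hb : b ∈ stdSimplex ℝ Y) :
    ent (prodLaw a b) = ent a + ent b := by
  simp only [ent, prodLaw, Fintype.sum_prod_type, negMulLog_mul, sum_add_distrib, ← mul_sum,
    ← sum_mul, hb.2, ha.2, one_mul]

lemma margXU_auxLaw [Fintype Y] {Q : U → ℝ} {A : U → X → ℝ} {B : U → Y → ℝ}
    (hB : ∀ u, B u ∈ stdSimplex ℝ Y) : margXU (auxLaw Q A B) = compLaw Q A := by
  funext z
  simp only [margXU, auxLaw, compLaw, prodLaw, ← mul_sum, (hB _).2, mul_one]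

lemma margYU_auxLaw [Fintype X] {Q : U → ℝ} {A : U → X → ℝ} {B : U → Y → ℝ}
    (hA : ∀ u, A u ∈ stdSimplex ℝ X) : margYU (auxLaw Q A B) = compLaw Q B := by
  funext z
  simp only [margYU, auxLaw, compLaw, prodLaw, ← mul_sum, ← sum_mul, (hA _).2, one_mul]

lemma sndMarginal_margXU [Fintype X] [Fintype Y] (t : (X × Y) × U → ℝ) :
    sndMarginal (margXU t) = sndMarginal t := by
  funext u
  simp [sndMarginal, margXU, Fintype.sum_prod_type]

lemma sndMarginal_margYU [Fintype X] [Fintype Y] (t : (X × Y) × U → ℝ) :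
    sndMarginal (margYU t) = sndMarginal t := by
  funext u
  simp [sndMarginal, margYU, Fintype.sum_prod_type_right]

lemma margXU_nonneg [Fintype Y] {t : (X × Y) × U → ℝ} (ht : ∀ z, 0 ≤ t z) (z : X × U) :
    0 ≤ margXU t z :=
  sum_nonneg fun _ _ => ht _

lemma margYU_nonneg [Fintype X] {t : (X × Y) × U → ℝ} (ht : ∀ z, 0 ≤ t z) (z : Y × U) :
    0 ≤ margYU t z :=
  sum_nonneg fun _ _ => ht _

lemma fstMarginal_margXU [Fintype Y] [Fintype U] (t : (X × Y) × U → ℝ) :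
    fstMarginal (margXU t) = fstMarginal (fstMarginal t) := by
  funext x
  exact sum_comm

lemma fstMarginal_margYU [Fintype X] [Fintype U] (t : (X × Y) × U → ℝ) :
    fstMarginal (margYU t) = sndMarginal (fstMarginal t) := by
  funext x
  exact sum_comm

variable [Fintype X] [Fintype Y] [Fintype U]

lemma auxLaw_mem_auxDists {Q : U → ℝ} {A : U → X → ℝ} {B : U → Y → ℝ} (hQ : Q ∈ stdSimplex ℝ U)
    (hA : ∀ u, A u ∈ stdSimplex ℝ X) (hB : ∀ u, B u ∈ stdSimplex ℝ Y) :
    auxLaw Q A B ∈ auxDists (fstMarginal (auxLaw Q A B)) U := by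
  refine ⟨compLaw_mem hQ fun u => prodLaw_mem (hA u) (hB u), rfl, fun x y u => ?_⟩
  rw [margXU_auxLaw hB, margYU_auxLaw hA, auxLaw,
    sndMarginal_compLaw fun u => prodLaw_mem (hA u) (hB u)]
  simp only [compLaw, prodLaw]
  ring

/-- The conditional law of `Z` given `U = u` when `(Z,U) ∼ s`, with value `d` when `U = u` has
probability zero. -/
def condLaw {Z U : Type*} [Fintype Z] (s : Z × U → ℝ) (d : Z → ℝ) (u : U) : Z → ℝ :=
  open Classical in if sndMarginal s u = 0 then d else fun z => s (z, u) / sndMarginal s u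

lemma condLaw_mem {Z U : Type*} [Fintype Z] {s : Z × U → ℝ} {d : Z → ℝ}
    (hd : d ∈ stdSimplex ℝ Z) (hs : ∀ z, 0 ≤ s z) (u : U) : condLaw s d u ∈ stdSimplex ℝ Z := by
  unfold condLaw
  split_ifs with h
  · exact hd
  · refine ⟨fun z => div_nonneg (hs _) (sndMarginal_nonneg hs u), ?_⟩
    rw [← sum_div]
    exact div_self h

lemma sndMarginal_mul_condLaw {Z U : Type*} [Fintype Z] {s : Z × U → ℝ} (d : Z → ℝ)
    (hs : ∀ z, 0 ≤ s z) (z : Z) (u : U) : sndMarginal s u * condLaw s d u z = s (z, u) := by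
  unfold condLaw
  split_ifs with h
  · rw [h, zero_mul]
    exact le_antisymm (hs _) (h ▸ le_sndMarginal hs z u)
  · exact mul_div_cancel₀ _ h

/-- In factored form `H(X,Y|U)` splits as `H(X|U) + H(Y|U)`, and the factors serve as the channels
of the coding scheme. The default laws given to `condLaw` only matter at symbols `u` of probability
zero. -/
lemma exists_eq_auxLaw {r : X × Y → ℝ} {t : (X × Y) × U → ℝ} (ht : t ∈ auxDists r U) :
    ∃ Q ∈ stdSimplex ℝ U, ∃ A : U → X → ℝ, ∃ B : U → Y → ℝ, (∀ u, A u ∈ stdSimplex ℝ X) ∧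
      (∀ u, B u ∈ stdSimplex ℝ Y) ∧ t = auxLaw Q A B := by
  classical
  obtain ⟨hs, rfl, hM⟩ := ht
  have hr := fstMarginal_mem hs
  refine ⟨sndMarginal t, sndMarginal_mem hs, _, _,
    condLaw_mem (fstMarginal_mem hr) (margXU_nonneg hs.1),
    condLaw_mem (sndMarginal_mem hr) (margYU_nonneg hs.1), ?_⟩
  funext ⟨⟨x, y⟩, u⟩
  have hX := sndMarginal_mul_condLaw (fstMarginal (fstMarginal t)) (margXU_nonneg hs.1) x u
  have hY := sndMarginal_mul_condLaw (sndMarginal (fstMarginal t)) (margYU_nonneg hs.1) y u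
  have h := hM x y u
  rw [sndMarginal_margXU] at hX
  rw [sndMarginal_margYU] at hY
  simp only [auxLaw, compLaw, prodLaw]
  rcases (sndMarginal_nonneg hs.1 u).eq_or_lt with h0 | h0
  · rw [← h0, zero_mul]
    exact le_antisymm (h0 ▸ le_sndMarginal hs.1 (x, y) u) (hs.1 _)
  · refine mul_right_cancel₀ h0.ne' ?_
    rw [h, ← hX, ← hY]
    ring

/-! ### Data processing -/

/-- This is `I(Y;U|X) ≥ 0`: Gibbs against `p(x,u) p(x,y) / p(x)`. -/
lemma ent_add_ent_le {t : (X × Y) × U → ℝ} (ht : ∀ z, 0 ≤ t z) :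
    ent t + ent (fstMarginal (fstMarginal t)) ≤ ent (margXU t) + ent (fstMarginal t) := by
  set r := fstMarginal t with hr
  set p := fstMarginal r with hp
  have hr0 : ∀ z, 0 ≤ r z := fstMarginal_nonneg ht
  have hp0 : ∀ x, 0 ≤ p x := fstMarginal_nonneg hr0
  have hle1 : ∀ x y u, t ((x, y), u) ≤ margXU t (x, u) := fun x y u =>
    single_le_sum (f := fun y => t ((x, y), u)) (fun _ _ => ht _) (mem_univ y)
  have hle2 : ∀ x y u, t ((x, y), u) ≤ r (x, y) := fun x y u => le_fstMarginal ht _ _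
  have hle3 : ∀ x y, r (x, y) ≤ p x := fun x y => le_fstMarginal hr0 _ _
  have hg := sum_mul_log_sub_log_nonneg (P := t)
    (Q := fun z => margXU t (z.1.1, z.2) * r z.1 / p z.1.1) ht
    (fun z => div_nonneg (mul_nonneg (margXU_nonneg ht _) (hr0 _)) (hp0 _))
    (by
      rintro ⟨⟨x, y⟩, u⟩ h
      simp only [div_eq_zero_iff, mul_eq_zero] at h
      have h0 := ht ((x, y), u)
      rcases h with (h | h) | h
      · linarith [hle1 x y u]
      · linarith [hle2 x y u]
      · linarith [hle2 x y u, hle3 x y])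
    (by
      have e : ∑ z, t z = ∑ x, p x := by rw [hp, sum_fstMarginal, hr, sum_fstMarginal]
      rw [e, Fintype.sum_prod_type, Fintype.sum_prod_type]
      refine sum_le_sum fun x _ => ?_
      have e1 : ∀ y, ∑ u, margXU t (x, u) * r (x, y) / p x = p x * r (x, y) / p x := by
        intro y
        rw [← sum_div, ← sum_mul]
        congr 2
        exact congrFun (fstMarginal_margXU t) x
      simp only [e1]
      rw [← sum_div, ← mul_sum]
      change p x * p x / p x ≤ p x
      rw [mul_self_div_self])
  have e : ∀ z : (X × Y) × U, t z * (log (t z) - log (margXU t (z.1.1, z.2) * r z.1 / p z.1.1)) =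
      t z * log (t z) - t z * log (margXU t (z.1.1, z.2)) - t z * log (r z.1)
        + t z * log (p z.1.1) := by
    rintro ⟨⟨x, y⟩, u⟩
    rcases (ht ((x, y), u)).eq_or_lt with h | h
    · simp [← h]
    · have h1 := h.trans_le (hle1 x y u)
      have h2 := h.trans_le (hle2 x y u)
      have h3 := h2.trans_le (hle3 x y)
      dsimp only
      rw [log_div (mul_pos h1 h2).ne' h3.ne', log_mul h1.ne' h2.ne']
      ring
  simp only [e, sum_add_distrib, sum_sub_distrib] at hg
  have s1 : ∑ z, t z * log (margXU t (z.1.1, z.2)) = ∑ z, margXU t z * log (margXU t z) := by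
    simp only [Fintype.sum_prod_type, margXU, sum_mul]
    refine sum_congr rfl fun x _ => ?_
    rw [sum_comm]
  have s2 : ∑ z, t z * log (r z.1) = ∑ z, r z * log (r z) := by
    rw [Fintype.sum_prod_type]
    exact sum_congr rfl fun z _ => by simp only [hr, fstMarginal, sum_mul]
  have s3 : ∑ z, t z * log (p z.1.1) = ∑ x, p x * log (p x) := by
    rw [Fintype.sum_prod_type, Fintype.sum_prod_type]
    exact sum_congr rfl fun x _ => by simp only [hp, hr, fstMarginal, sum_mul]
  rw [s1, s2, s3] at hg
  simp only [ent_eq_neg_sum]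
  linarith

lemma mutualInfo_margXU_le {t : (X × Y) × U → ℝ} (ht : ∀ z, 0 ≤ t z) :
    mutualInfo (margXU t) ≤ mutualInfo t := by
  refine le_of_mul_le_mul_right ?_ log_two_pos
  rw [mutualInfo_mul_log_two_eq_ent ht, mutualInfo_mul_log_two_eq_ent (margXU_nonneg ht),
    sndMarginal_margXU, fstMarginal_margXU]
  linarith [ent_add_ent_le ht]

/-- The law of `((Y,X),U)` when `((X,Y),U) ∼ t`. -/
def swapXY {X Y U : Type*} (t : (X × Y) × U → ℝ) : (Y × X) × U → ℝ :=
  fun z => t ((z.1.2, z.1.1), z.2)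

/-- With `X` and `Y` exchanged, `ent_add_ent_le` bounds `H(X|Y,U)` by `H(X|Y)`; the Markov property
identifies `H(X|Y,U)` with `H(X|U)`. -/
lemma mutualInfo_le_mutualInfo_margXU {r : X × Y → ℝ} {t : (X × Y) × U → ℝ}
    (ht : t ∈ auxDists r U) : mutualInfo r ≤ mutualInfo (margXU t) := by
  obtain ⟨Q, hQ, A, B, hA, hB, rfl⟩ := exists_eq_auxLaw ht
  obtain ⟨hs, rfl, -⟩ := ht
  have hAB : ∀ u, prodLaw (A u) (B u) ∈ stdSimplex ℝ (X × Y) := fun u => prodLaw_mem (hA u) (hB u)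
  set t := auxLaw Q A B with htdef
  have h := ent_add_ent_le (t := swapXY t) fun z => hs.1 _
  have e1 : ent (swapXY t) = ent t :=
    Fintype.sum_equiv ((Equiv.prodComm Y X).prodCongr (Equiv.refl U)) _ _ fun z => rfl
  have e2 : ent (fstMarginal (swapXY t)) = ent (fstMarginal t) :=
    Fintype.sum_equiv (Equiv.prodComm Y X) _ _ fun z => rfl
  have e3 : fstMarginal (fstMarginal (swapXY t)) = sndMarginal (fstMarginal t) := rfl
  have e4 : margXU (swapXY t) = margYU t := rfl
  rw [e1, e2, e3, e4] at h
  have i1 := mutualInfo_mul_log_two_eq_ent (r := t) hs.1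
  have i2 := mutualInfo_mul_log_two_eq_ent (r := margYU t) (margYU_nonneg hs.1)
  have i3 := mutualInfo_mul_log_two_eq_ent (fstMarginal_mem hs).1
  have k1 := mutualInfo_compLaw (Q := Q) hQ.1 hAB
  have k2 := mutualInfo_compLaw (Q := Q) hQ.1 hB
  have k3 := mutualInfo_compLaw (Q := Q) hQ.1 hA
  rw [← margYU_auxLaw (B := B) hA, ← htdef] at k2
  rw [← margXU_auxLaw (A := A) hB, ← htdef] at k3
  change mutualInfo t * log 2 = ent (fstMarginal t) - _ at k1
  simp only [ent_prodLaw (hA _) (hB _), mul_add, sum_add_distrib] at k1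
  rw [sndMarginal_margYU] at i2
  rw [fstMarginal_margYU] at i2 k2
  rw [fstMarginal_margXU] at k3
  refine le_of_mul_le_mul_right ?_ log_two_pos
  linarith

end structural

/-! ### Reduction of the alphabet of the auxiliary variable -/

/-- Carathéodory in linear-programming form. While the support has more than `|E|` points, their
vectors `φ u` are dependent; moving `w` along a dependency, in the sense that does not decrease the
objective `h`, removes a point. -/
lemma exists_small_support {U E : Type*} [Fintype U] [Fintype E] (φ : U → E → ℝ) (h : U → ℝ)
    {l : E → ℝ} (hl : ∀ u, ∑ e, l e * φ u e = 1) (w : U → ℝ) (hw : ∀ u, 0 ≤ w u) :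
    ∃ w' : U → ℝ, (∀ u, 0 ≤ w' u) ∧ (∀ e, ∑ u, w' u * φ u e = ∑ u, w u * φ u e) ∧
      ∑ u, w u * h u ≤ ∑ u, w' u * h u ∧ Nat.card {u // w' u ≠ 0} ≤ Fintype.card E := by
  classical
  induction hn : Nat.card {u // w u ≠ 0} using Nat.strong_induction_on generalizing w with
  | _ n ih =>
  by_cases hcard : n ≤ Fintype.card E
  · exact ⟨w, hw, fun _ => rfl, le_rfl, hn ▸ hcard⟩
  have hdep : ¬ LinearIndependent ℝ fun u : {u // w u ≠ 0} => φ u := by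
    intro hli
    have := hli.fintype_card_le_finrank
    rw [Module.finrank_fintype_fun_eq_card, ← Nat.card_eq_fintype_card, hn] at this
    exact hcard this
  rw [Fintype.not_linearIndependent_iff] at hdep
  obtain ⟨g, hg, ⟨i, hi⟩⟩ := hdep
  obtain ⟨v, hv0, hvs, ⟨a, ha⟩, hvh⟩ : ∃ v : U → ℝ, (∀ e, ∑ u, v u * φ u e = 0) ∧
      (∀ u, w u = 0 → v u = 0) ∧ (∃ u, v u ≠ 0) ∧ 0 ≤ ∑ u, v u * h u := by
    let v : U → ℝ := fun u => if hu : w u ≠ 0 then g ⟨u, hu⟩ else 0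
    have hv0 : ∀ e, ∑ u, v u * φ u e = 0 := by
      intro e
      have := congrFun hg e
      simp only [Finset.sum_apply, Pi.smul_apply, smul_eq_mul, Pi.zero_apply] at this
      rw [← this]
      refine (Fintype.sum_of_injective (fun u : {u // w u ≠ 0} => (u : U))
        Subtype.val_injective _ _ (fun u hu => ?_) fun u => ?_).symm
      · have : w u = 0 := by simpa using hu
        simp [v, this]
      · simp [v, u.2]
    have hvs : ∀ u, w u = 0 → v u = 0 := fun u hu => by simp [v, hu]
    have hvi : v i ≠ 0 := by simpa [v, i.2] using hi
    rcases le_total 0 (∑ u, v u * h u) with hh | hh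
    · exact ⟨v, hv0, hvs, ⟨i, hvi⟩, hh⟩
    · exact ⟨fun u => -v u, fun e => by simp [hv0 e], fun u hu => by simp [hvs u hu],
        ⟨i, by simpa using hvi⟩, by simpa using hh⟩
  -- Total mass is a combination `l` of the preserved functionals, so the direction has mass zero
  -- and, being nonzero, a negative entry.
  have hvsum : ∑ u, v u = 0 := by
    calc ∑ u, v u = ∑ u, ∑ e, l e * (v u * φ u e) := by
          refine sum_congr rfl fun u _ => ?_
          have := congrArg (v u * ·) (hl u)
          simp only [mul_one, mul_sum] at this
          refine this.symm.trans ?_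
          exact sum_congr rfl fun e _ => by ring
      _ = 0 := by rw [sum_comm]; simp [← mul_sum, hv0]
  obtain ⟨b, hb⟩ : ∃ b, v b < 0 := by
    by_contra! hc
    exact ha ((sum_eq_zero_iff_of_nonneg fun u _ => hc u).1 hvsum a (mem_univ a))
  -- The smallest ratio is the longest step that keeps all weights nonnegative; it annihilates the
  -- weight at `c`.
  obtain ⟨c, hc, hmin⟩ := exists_min_image (univ.filter fun u => v u < 0) (fun u => w u / -v u)
    ⟨b, by simpa using hb⟩
  simp only [mem_filter, mem_univ, true_and] at hc hmin
  set s := w c / -v c with hs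
  have hs0 : 0 ≤ s := div_nonneg (hw c) (by linarith)
  let w' : U → ℝ := fun u => w u + s * v u
  have hw' : ∀ u, 0 ≤ w' u := by
    intro u
    rcases lt_or_ge (v u) 0 with hu | hu
    · have := hmin u hu
      rw [le_div_iff₀ (by linarith)] at this
      simp only [w']; linarith
    · exact add_nonneg (hw u) (mul_nonneg hs0 hu)
  have hw'c : w' c = 0 := by
    have : v c ≠ 0 := hc.ne
    simp only [w', hs]
    field_simp
    ring
  have hlt : Nat.card {u // w' u ≠ 0} < n := by
    rw [← hn, Nat.card_eq_fintype_card, Nat.card_eq_fintype_card, Fintype.card_subtype,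
      Fintype.card_subtype]
    refine card_lt_card ⟨fun u hu => ?_, fun hsub => ?_⟩
    · simp only [mem_filter, mem_univ, true_and] at hu ⊢
      exact fun h0 => hu (by simp [w', h0, hvs u h0])
    · have := hsub (x := c) (by simpa using fun h0 => hc.ne (hvs c h0))
      simp [hw'c] at this
  obtain ⟨w'', h1, h2, h3, h4⟩ := ih _ hlt w' hw' rfl
  refine ⟨w'', h1, fun e => ?_, le_trans ?_ h3, h4⟩
  · rw [h2 e]
    simp only [w', add_mul, sum_add_distrib, mul_assoc, ← mul_sum, hv0 e, mul_zero, add_zero]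
  · simp only [w', add_mul, sum_add_distrib, mul_assoc, ← mul_sum]
    linarith [mul_nonneg hs0 hvh]

lemma exists_reindex {U : Type*} [Fintype U] [Nonempty U] (w : U → ℝ) (hw : ∀ u, 0 ≤ w u) {N : ℕ}
    (hN : Nat.card {u // w u ≠ 0} ≤ N) :
    ∃ (g : Fin N → U) (v : Fin N → ℝ), (∀ i, 0 ≤ v i) ∧
      ∀ F : U → ℝ, ∑ i, v i * F (g i) = ∑ u, w u * F u := by
  classical
  obtain ⟨j⟩ : Nonempty ({u // w u ≠ 0} ↪ Fin N) :=
    Function.Embedding.nonempty_of_card_le (by simpa [Nat.card_eq_fintype_card] using hN)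
  refine ⟨Function.extend j Subtype.val fun _ => Classical.arbitrary U,
    Function.extend j (fun u => w u) 0, fun i => ?_, fun F => ?_⟩
  · by_cases hi : ∃ u, j u = i
    · obtain ⟨u, rfl⟩ := hi
      rw [j.injective.extend_apply]
      exact hw u
    · rw [Function.extend_apply' _ _ _ hi]
      exact le_rfl
  · trans ∑ u : {u // w u ≠ 0}, w u * F u
    · refine (Fintype.sum_of_injective j j.injective _ _ (fun i hi => ?_) fun u => ?_).symm
      · rw [Function.extend_apply' _ _ _ hi]
        simp
      · rw [j.injective.extend_apply, j.injective.extend_apply]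
    · refine Fintype.sum_of_injective (fun u : {u // w u ≠ 0} => (u : U))
        Subtype.val_injective _ _ (fun u hu => ?_) fun u => rfl
      have : w u = 0 := by simpa using hu
      simp [this]

/-- The preserved functionals are the `|X||Y|` cell probabilities, which also fix the total mass,
and `H(X|U)` (the index `none`). `H(X,Y|U)` is the objective: it may only grow, so `I(X,Y;U)` may
only drop, and it costs no extra symbol. Reweighting product kernels keeps the chain Markov. -/
theorem exists_auxDists_card_le {X Y U : Type*} [Fintype X] [Fintype Y] [Fintype U]
    {r : X × Y → ℝ} {t : (X × Y) × U → ℝ} (ht : t ∈ auxDists r U) :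
    ∃ t' ∈ auxDists r (Fin (Fintype.card X * Fintype.card Y + 1)),
      mutualInfo (margXU t') ≤ mutualInfo (margXU t) ∧ mutualInfo t' ≤ mutualInfo t := by
  obtain ⟨Q, hQ, A, B, hA, hB, rfl⟩ := exists_eq_auxLaw ht
  obtain ⟨-, rfl, -⟩ := ht
  have hAB : ∀ u, prodLaw (A u) (B u) ∈ stdSimplex ℝ (X × Y) := fun u => prodLaw_mem (hA u) (hB u)
  have hU : Nonempty U := by
    by_contra hc
    rw [not_nonempty_iff] at hc
    simpa using hQ.2
  obtain ⟨w, hw0, hwφ, hwh, hcard⟩ := exists_small_support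
    (E := Option (X × Y))
    (fun u e => e.elim (ent (A u)) (prodLaw (A u) (B u))) (fun u => ent (prodLaw (A u) (B u)))
    (l := fun e => e.elim 0 fun _ => 1)
    (fun u => by simp [Fintype.sum_option, (hAB u).2]) Q hQ.1
  rw [Fintype.card_option, Fintype.card_prod] at hcard
  obtain ⟨g, v, hv0, hv⟩ := exists_reindex w hw0 hcard
  have hfst : fstMarginal (auxLaw v (fun i => A (g i)) fun i => B (g i)) =
      fstMarginal (auxLaw Q A B) := by
    funext z
    have := hwφ (some z)
    simp only [Option.elim_some] at this
    exact (hv fun u => prodLaw (A u) (B u) z).trans this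
  have hent : ∑ i, v i * ent (A (g i)) = ∑ u, Q u * ent (A u) := by
    have := hwφ none
    simp only [Option.elim_none] at this
    rw [← this, ← hv fun u => ent (A u)]
  have hvmem : v ∈ stdSimplex ℝ (Fin (Fintype.card X * Fintype.card Y + 1)) := by
    refine ⟨hv0, ?_⟩
    rw [← sndMarginal_compLaw (Q := v) fun i => hAB (g i), sum_sndMarginal, ← sum_fstMarginal]
    change ∑ z, fstMarginal (auxLaw v (fun i => A (g i)) fun i => B (g i)) z = 1
    rw [hfst, sum_fstMarginal]
    exact (compLaw_mem hQ hAB).2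
  refine ⟨auxLaw v (fun i => A (g i)) fun i => B (g i), ?_, ?_, ?_⟩
  · rw [← hfst]
    exact auxLaw_mem_auxDists hvmem (fun i => hA _) fun i => hB _
  · refine le_of_mul_le_mul_right ?_ log_two_pos
    have e1 := fstMarginal_margXU (auxLaw v (fun i => A (g i)) fun i => B (g i))
    have e2 := fstMarginal_margXU (auxLaw Q A B)
    rw [margXU_auxLaw (fun i => hB _)] at e1 ⊢
    rw [margXU_auxLaw hB] at e2 ⊢
    rw [mutualInfo_compLaw hv0 fun i => hA _, mutualInfo_compLaw hQ.1 hA, e1, e2, hfst, hent]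
  · refine le_of_mul_le_mul_right ?_ log_two_pos
    rw [auxLaw, mutualInfo_compLaw hv0 fun i => hAB _, auxLaw, mutualInfo_compLaw hQ.1 hAB]
    change ent (fstMarginal (auxLaw v (fun i => A (g i)) fun i => B (g i))) - _ ≤
      ent (fstMarginal (auxLaw Q A B)) - _
    rw [hfst, hv fun u => ent (prodLaw (A u) (B u))]
    linarith

/-! ### Compactness -/

lemma continuous_ent_add_ent_sub_ent {α β : Type*} [Fintype α] [Fintype β] :
    Continuous fun s : α × β → ℝ => ent (fstMarginal s) + ent (sndMarginal s) - ent s := by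
  unfold ent fstMarginal sndMarginal
  fun_prop

/-- On a fixed alphabet the simplex is compact, the constraints are closed, and mutual information
is a continuous combination of entropies. The pair law may vary with `n`, since a code supplies it
only approximately. -/
lemma exists_auxDists_of_tendsto {X Y : Type*} [Fintype X] [Fintype Y] {N : ℕ}
    {r : ℕ → X × Y → ℝ} {r₀ : X × Y → ℝ} {t : ℕ → (X × Y) × Fin N → ℝ} {a b : ℕ → ℝ} {a₀ b₀ : ℝ}
    (ht : ∀ n, t n ∈ auxDists (r n) (Fin N)) (hr : Filter.Tendsto r Filter.atTop (nhds r₀))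
    (ha : Filter.Tendsto a Filter.atTop (nhds a₀)) (hb : Filter.Tendsto b Filter.atTop (nhds b₀))
    (hta : ∀ n, mutualInfo (margXU (t n)) ≤ a n) (htb : ∀ n, mutualInfo (t n) ≤ b n) :
    ∃ t₀ ∈ auxDists r₀ (Fin N), mutualInfo (margXU t₀) ≤ a₀ ∧ mutualInfo t₀ ≤ b₀ := by
  obtain ⟨t₀, ht₀, ψ, hψ, hlim⟩ :=
    (isCompact_stdSimplex ℝ ((X × Y) × Fin N)).tendsto_subseq fun n => (ht n).1
  have hc1 : Continuous (fstMarginal : ((X × Y) × Fin N → ℝ) → _) := by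
    unfold fstMarginal; fun_prop
  have hc2 : Continuous (margXU : ((X × Y) × Fin N → ℝ) → _) := by
    unfold margXU; fun_prop
  have hc3 : Continuous (margYU : ((X × Y) × Fin N → ℝ) → _) := by
    unfold margYU; fun_prop
  have hc4 : Continuous (sndMarginal : ((X × Y) × Fin N → ℝ) → _) := by
    unfold sndMarginal; fun_prop
  refine ⟨t₀, ⟨ht₀, ?_, ?_⟩, ?_, ?_⟩
  · have h1 := (hc1.tendsto t₀).comp hlim
    refine tendsto_nhds_unique h1 ?_
    convert hr.comp hψ.tendsto_atTop using 1
    funext n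
    exact (ht (ψ n)).2.1
  · intro x y u
    have f1 : Continuous fun s : (X × Y) × Fin N → ℝ => s ((x, y), u) * sndMarginal s u := by
      fun_prop
    have f2 : Continuous fun s : (X × Y) × Fin N → ℝ => margXU s (x, u) * margYU s (y, u) := by
      fun_prop
    refine tendsto_nhds_unique ((f1.tendsto t₀).comp hlim) ?_
    convert (f2.tendsto t₀).comp hlim using 1
    funext n
    exact (ht (ψ n)).2.2 x y u
  · refine le_of_mul_le_mul_right ?_ log_two_pos
    rw [mutualInfo_mul_log_two_eq_ent (margXU_nonneg ht₀.1)]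
    refine le_of_tendsto_of_tendsto'
      (((continuous_ent_add_ent_sub_ent.comp hc2).tendsto t₀).comp hlim)
      ((ha.comp hψ.tendsto_atTop).mul_const (log 2)) fun n => ?_
    simp only [Function.comp_apply]
    rw [← mutualInfo_mul_log_two_eq_ent (margXU_nonneg (ht (ψ n)).1.1)]
    exact mul_le_mul_of_nonneg_right (hta _) log_two_pos.le
  · refine le_of_mul_le_mul_right ?_ log_two_pos
    rw [mutualInfo_mul_log_two_eq_ent ht₀.1]
    refine le_of_tendsto_of_tendsto' ((continuous_ent_add_ent_sub_ent.tendsto t₀).comp hlim)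
      ((hb.comp hψ.tendsto_atTop).mul_const (log 2)) fun n => ?_
    simp only [Function.comp_apply]
    rw [← mutualInfo_mul_log_two_eq_ent (ht (ψ n)).1.1]
    exact mul_le_mul_of_nonneg_right (htb _) log_two_pos.le

lemma mem_rateSet_of_auxDists {X Y U : Type*} [Fintype X] [Fintype Y] [Fintype U] {p : X → ℝ}
    {q : X → Y → ℝ} {R : ℝ × ℝ} (hR : 0 ≤ R.2) {t : (X × Y) × U → ℝ}
    (ht : t ∈ auxDists (jointDist p q) U) (h1 : mutualInfo (margXU t) ≤ R.1)
    (h2 : mutualInfo t ≤ R.1 + R.2) : R ∈ rateSet p q := by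
  obtain ⟨t', ht', h1', h2'⟩ := exists_auxDists_card_le ht
  exact ⟨hR, _, le_rfl, t', ht', h1'.trans h1, h2'.trans h2⟩

lemma isClosed_rateSet {X Y : Type*} [Fintype X] [Fintype Y] (p : X → ℝ) (q : X → Y → ℝ) :
    IsClosed (rateSet p q) := by
  refine isClosed_of_closure_subset fun R hR => ?_
  obtain ⟨S, hS, hlim⟩ := mem_closure_iff_seq_limit.1 hR
  have key : ∀ n, ∃ t ∈ auxDists (jointDist p q) (Fin (Fintype.card X * Fintype.card Y + 1)),
      mutualInfo (margXU t) ≤ (S n).1 ∧ mutualInfo t ≤ (S n).1 + (S n).2 := by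
    intro n
    obtain ⟨-, m, -, t, ht, h1, h2⟩ := hS n
    obtain ⟨t', ht', h1', h2'⟩ := exists_auxDists_card_le ht
    exact ⟨t', ht', h1'.trans h1, h2'.trans h2⟩
  choose t ht h1 h2 using key
  have l1 := (continuous_fst.tendsto R).comp hlim
  have l2 := (continuous_snd.tendsto R).comp hlim
  obtain ⟨t₀, ht₀, h1₀, h2₀⟩ :=
    exists_auxDists_of_tendsto ht tendsto_const_nhds l1 (l1.add l2) h1 h2
  exact ⟨ge_of_tendsto' l2 fun n => (hS n).1, _, le_rfl, t₀, ht₀, h1₀, h2₀⟩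

/-! ### Converse -/

section zip

variable {ι X Y : Type*}

/-- A law of `(Xⁿ, Yⁿ)`, seen as a law of a vector of pairs. -/
def zipLaw (P : (ι → X) × (ι → Y) → ℝ) : (ι → X × Y) → ℝ :=
  fun v => P (fun k => (v k).1, fun k => (v k).2)

variable [Fintype ι] [DecidableEq ι] [Fintype X] [Fintype Y]

lemma sum_zipLaw (P : (ι → X) × (ι → Y) → ℝ) :
    ∑ v, zipLaw P v = ∑ z, P z :=
  Fintype.sum_equiv (Equiv.arrowProdEquivProdArrow ι (fun _ => X) fun _ => Y) _ _ fun _ => rfl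

lemma ent_zipLaw (P : (ι → X) × (ι → Y) → ℝ) : ent (zipLaw P) = ent P :=
  sum_zipLaw fun z => negMulLog (P z)

/-- Independence of the blocks given the indices passes to each coordinate pair; this is what keeps
the single-letter chain Markov. -/
lemma coordMarg_zipLaw_prodLaw (k : ι) (a : (ι → X) → ℝ) (b : (ι → Y) → ℝ) :
    coordMarg k (zipLaw (prodLaw a b)) = prodLaw (coordMarg k a) (coordMarg k b) := by
  classical
  funext z
  have := sum_zipLaw (fun w : (ι → X) × (ι → Y) =>
    (if w.1 k = z.1 then a w.1 else 0) * if w.2 k = z.2 then b w.2 else 0)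
  rw [Fintype.sum_prod_type] at this
  simp only [← mul_sum, ← sum_mul] at this
  simp only [coordMarg, prodLaw]
  rw [← this]
  refine sum_congr rfl fun v _ => ?_
  simp only [zipLaw, Prod.ext_iff, ← ite_and, ite_mul, zero_mul, mul_ite, mul_zero]
  by_cases h1 : (v k).1 = z.1 <;> by_cases h2 : (v k).2 = z.2 <;> simp [h1, h2, prodLaw]

end zip

lemma coordMarg_sum_mul {ι U V : Type*} [Fintype ι] [DecidableEq ι] [Fintype U] [Fintype V]
    (k : ι) (Q : V → ℝ) (P : V → (ι → U) → ℝ) (u : U) :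
    coordMarg k (fun c => ∑ w, Q w * P w c) u = ∑ w, Q w * coordMarg k (P w) u := by
  classical
  simp only [coordMarg, mul_sum]
  rw [sum_comm]
  refine sum_congr rfl fun c _ => ?_
  split_ifs <;> simp

lemma zipLaw_iidDist {X Y : Type*} (p : X → ℝ) (q : X → Y → ℝ) (n : ℕ) :
    zipLaw (iidDist p q n) = iid (jointDist p q) := rfl

lemma jointDist_mem {X Y : Type*} [Fintype X] [Fintype Y] {p : X → ℝ} (hp : p ∈ stdSimplex ℝ X)
    {q : X → Y → ℝ} (hq : ∀ x, q x ∈ stdSimplex ℝ Y) : jointDist p q ∈ stdSimplex ℝ (X × Y) := by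
  refine ⟨fun z => mul_nonneg (hp.1 _) ((hq _).1 _), ?_⟩
  simp only [jointDist, Fintype.sum_prod_type, ← mul_sum, (hq _).2, mul_one, hp.2]

lemma iidDist_mem {X Y : Type*} [Fintype X] [Fintype Y] {p : X → ℝ} (hp : p ∈ stdSimplex ℝ X)
    {q : X → Y → ℝ} (hq : ∀ x, q x ∈ stdSimplex ℝ Y) (n : ℕ) :
    iidDist p q n ∈ stdSimplex ℝ ((Fin n → X) × (Fin n → Y)) := by
  refine ⟨fun z => prod_nonneg fun k _ => (jointDist_mem hp hq).1 _, ?_⟩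
  rw [← sum_zipLaw, zipLaw_iidDist]
  exact (iid_mem (jointDist_mem hp hq)).2

/-! ### Single-letterization by a uniform time index -/

section singleLetter

variable {X V : Type*} [Fintype X] [Fintype V] {n : ℕ}

/-- The law of `(W, K)`, where `W ∼ Q` and `K` is an independent uniform time index. -/
def timeLaw (n : ℕ) (Q : V → ℝ) : V × Fin n → ℝ := fun u => Q u.1 / n

lemma sum_timeLaw_mul (Q : V → ℝ) (F : V × Fin n → ℝ) :
    ∑ u, timeLaw n Q u * F u = (∑ w, Q w * ∑ k, F (w, k)) / n := by
  rw [Fintype.sum_prod_type, sum_div]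
  refine sum_congr rfl fun w _ => ?_
  rw [mul_sum, sum_div]
  exact sum_congr rfl fun k _ => by simp only [timeLaw]; ring

lemma timeLaw_mem (hn : n ≠ 0) {Q : V → ℝ} (hQ : Q ∈ stdSimplex ℝ V) :
    timeLaw n Q ∈ stdSimplex ℝ (V × Fin n) := by
  refine ⟨fun u => div_nonneg (hQ.1 _) n.cast_nonneg, ?_⟩
  have := sum_timeLaw_mul (n := n) Q fun _ => 1
  simp only [mul_one, sum_const, card_univ, Fintype.card_fin, nsmul_eq_mul, ← sum_mul, hQ.2,
    one_mul] at this
  rw [this, div_self (by exact_mod_cast hn)]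

lemma fstMarginal_compLaw_timeLaw (Q : V → ℝ) (P : V → (Fin n → X) → ℝ) (x : X) :
    fstMarginal (compLaw (timeLaw n Q) fun u => coordMarg u.2 (P u.1)) x =
      (∑ k, coordMarg k (fstMarginal (compLaw Q P)) x) / n := by
  refine (sum_timeLaw_mul Q fun u => coordMarg u.2 (P u.1) x).trans ?_
  congr 1
  simp only [mul_sum]
  rw [sum_comm]
  exact sum_congr rfl fun k _ => (coordMarg_sum_mul k Q P x).symm

/-- Subadditivity for each value of `W`: `H(Xⁿ|W) / n ≤ H(X_K|W,K)`. -/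
lemma sum_mul_ent_le_timeLaw {Q : V → ℝ} (hQ : ∀ w, 0 ≤ Q w) {P : V → (Fin n → X) → ℝ}
    (hP : ∀ w, P w ∈ stdSimplex ℝ (Fin n → X)) :
    (∑ w, Q w * ent (P w)) / n ≤ ∑ u, timeLaw n Q u * ent (coordMarg u.2 (P u.1)) := by
  rw [sum_timeLaw_mul Q fun u => ent (coordMarg u.2 (P u.1))]
  refine div_le_div_of_nonneg_right ?_ n.cast_nonneg
  exact sum_le_sum fun w _ => mul_le_mul_of_nonneg_left (ent_le_sum_ent_coordMarg (hP w)) (hQ w)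

end singleLetter

/-- The auxiliary variable is `((I, J), K)`, and `r` averages the coordinate laws of the induced
block law. The first information bound has no error term because the `X`-marginal is exactly `p`;
the second pays for replacing `H(Xⁿ,Yⁿ)` by its i.i.d. value and for `r` differing from the target.
-/
lemma exists_auxDists_of_code {X Y : Type*} [Fintype X] [Fintype Y] {p : X → ℝ}
    (hp : p ∈ stdSimplex ℝ X) {q : X → Y → ℝ} (hq : ∀ x, q x ∈ stdSimplex ℝ Y) {n M N : ℕ}
    (hn : n ≠ 0) (hM : M ≠ 0) (hN : N ≠ 0) (c : Code X Y n M N) :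
    ∃ r, ∃ t ∈ auxDists r ((Fin M × Fin N) × Fin n),
      (∀ z, |r z - jointDist p q z| ≤ 2 * tvDist (c.inducedXY p) (iidDist p q n)) ∧
      mutualInfo (margXU t) * log 2 ≤ log M / n ∧
      mutualInfo t * log 2 ≤ ent r - ent (jointDist p q)
        + tvDist (c.inducedXY p) (iidDist p q n) * log (Fintype.card X * Fintype.card Y)
        + (negMulLog (tvDist (c.inducedXY p) (iidDist p q n))
          + tvDist (c.inducedXY p) (iidDist p q n)) / n
        + (log M + log N) / n := by
  have hn' : (0 : ℝ) < n := by exact_mod_cast Nat.pos_of_ne_zero hn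
  have hM' : (0 : ℝ) < M := by exact_mod_cast Nat.pos_of_ne_zero hM
  have hN' : (0 : ℝ) < N := by exact_mod_cast Nat.pos_of_ne_zero hN
  set δ := tvDist (c.inducedXY p) (iidDist p q n) with hδ
  have hpn : (iid p : (Fin n → X) → ℝ) ∈ stdSimplex ℝ (Fin n → X) := iid_mem hp
  let s : (Fin n → X) × (Fin M × Fin N) → ℝ := fun z => 1 / N * iid p z.1 * c.enc z.1 z.2.2 z.2.1
  have hs0 : ∀ z, 0 ≤ s z := fun z =>
    mul_nonneg (mul_nonneg (by positivity) (hpn.1 _)) ((c.enc_mem _ _).1 _)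
  have hsfst : fstMarginal s = iid p := by
    funext x
    simp only [fstMarginal, s, Fintype.sum_prod_type_right, ← mul_sum, (c.enc_mem _ _).2]
    simp only [mul_one, sum_const, card_univ, Fintype.card_fin, nsmul_eq_mul]
    field_simp
  have hs : s ∈ stdSimplex ℝ _ := ⟨hs0, by rw [← sum_fstMarginal, hsfst, hpn.2]⟩
  set Q := sndMarginal s with hQdef
  have hQ : Q ∈ stdSimplex ℝ _ := sndMarginal_mem hs
  -- The law of `Xⁿ` given the indices. The decoder sees only the indices, so with `β` it factors
  -- the induced law.
  let α := condLaw s (iid p)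
  have hα : ∀ w, α w ∈ stdSimplex ℝ _ := condLaw_mem hpn hs0
  let β : Fin M × Fin N → (Fin n → Y) → ℝ := fun w => c.dec w.1 w.2
  have hβ : ∀ w, β w ∈ stdSimplex ℝ _ := fun w => c.dec_mem _ _
  have hsα : compLaw Q α = s := by
    funext z
    exact sndMarginal_mul_condLaw _ hs0 z.1 z.2
  have hind : fstMarginal (auxLaw Q α β) = c.inducedXY p := by
    funext z
    simp only [fstMarginal, auxLaw, compLaw, prodLaw, Code.inducedXY, Fintype.sum_prod_type]
    refine sum_congr rfl fun i _ => sum_congr rfl fun j _ => ?_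
    rw [← mul_assoc, show Q (i, j) * α (i, j) z.1 = s (z.1, (i, j)) from
      congrFun hsα (z.1, (i, j))]
    rfl
  have hαβ : ∀ w, prodLaw (α w) (β w) ∈ stdSimplex ℝ _ := fun w => prodLaw_mem (hα w) (hβ w)
  have hL : auxLaw Q α β ∈ stdSimplex ℝ _ := compLaw_mem hQ hαβ
  have hindmem : c.inducedXY p ∈ stdSimplex ℝ _ := hind ▸ fstMarginal_mem hL
  have hcard : log (Fintype.card (Fin M × Fin N)) = log M + log N := by
    rw [Fintype.card_prod, Fintype.card_fin, Fintype.card_fin, Nat.cast_mul,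
      log_mul hM'.ne' hN'.ne']
  have hI1 : n * ent p - ∑ w, Q w * ent (α w) ≤ log M := by
    -- Here `p(i,j|xⁿ) = p(i|xⁿ,j) / N ≤ 1 / N`, which cancels the `log N` in the log-cardinality of
    -- the index pairs.
    have h := mutualInfo_le_log_card hs (c := 1 / N) (by positivity) fun x w => by
      rw [hsfst]
      refine mul_le_of_le_one_right (mul_nonneg (by positivity) (hpn.1 _)) ?_
      exact (c.enc_mem x w.2).2 ▸ single_le_sum (fun i _ => (c.enc_mem x w.2).1 i) (mem_univ w.1)
    rw [← hsα, mutualInfo_compLaw hQ.1 hα, hsα, hsfst, ent_iid hp, hcard, one_div, log_inv,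
      Fintype.card_fin] at h
    linarith
  have hI2 : ent (c.inducedXY p) - ∑ w, Q w * (ent (α w) + ent (β w)) ≤ log M + log N := by
    have h := mutualInfo_le_log_card hL (c := 1) one_pos fun x w => by
      rw [one_mul]
      exact le_fstMarginal hL.1 x w
    rw [auxLaw, mutualInfo_compLaw hQ.1 hαβ, hcard, log_one, zero_add] at h
    change ent (fstMarginal (auxLaw Q α β)) - _ ≤ _ at h
    simpa only [hind, ent_prodLaw (hα _) (hβ _)] using h
  have hfan := ent_le_ent_add_tvDist hindmem (iidDist_mem hp hq n)
  rw [← ent_zipLaw (iidDist p q n), zipLaw_iidDist, ent_iid (jointDist_mem hp hq),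
    Fintype.card_fin, ← hδ, Fintype.card_prod, Fintype.card_fun, Fintype.card_fun,
    Fintype.card_fin, ← mul_pow, Nat.cast_pow, log_pow, Nat.cast_mul] at hfan
  have hA : ∀ u : (Fin M × Fin N) × Fin n, coordMarg u.2 (α u.1) ∈ stdSimplex ℝ X :=
    fun u => coordMarg_mem _ (hα _)
  have hB : ∀ u : (Fin M × Fin N) × Fin n, coordMarg u.2 (β u.1) ∈ stdSimplex ℝ Y :=
    fun u => coordMarg_mem _ (hβ _)
  have hT := timeLaw_mem hn hQ
  have hr : ∀ z, fstMarginal (auxLaw (timeLaw n Q) (fun u => coordMarg u.2 (α u.1))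
      fun u => coordMarg u.2 (β u.1)) z =
      (∑ k, coordMarg k (zipLaw (c.inducedXY p)) z) / n := by
    intro z
    have h := fstMarginal_compLaw_timeLaw Q (fun w => zipLaw (prodLaw (α w) (β w))) z
    simp only [coordMarg_zipLaw_prodLaw] at h
    rw [auxLaw, h, ← hind]
    rfl
  refine ⟨_, _, auxLaw_mem_auxDists hT hA hB, ?_, ?_, ?_⟩
  · intro z
    have hk : ∀ k, |coordMarg k (zipLaw (c.inducedXY p)) z - jointDist p q z| ≤ 2 * δ := by
      intro k
      have h1 := sum_abs_coordMarg_sub_le k (zipLaw (c.inducedXY p)) (zipLaw (iidDist p q n))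
      rw [zipLaw_iidDist, coordMarg_iid (jointDist_mem hp hq)] at h1
      have h2 := sum_zipLaw fun z => |c.inducedXY p z - iidDist p q n z|
      have h3 : ∑ z, |c.inducedXY p z - iidDist p q n z| = 2 * δ := by
        rw [hδ, tvDist]; ring
      rw [← h3, ← h2]
      exact (single_le_sum (f := fun z =>
        |coordMarg k (zipLaw (c.inducedXY p)) z - jointDist p q z|)
        (fun _ _ => abs_nonneg _) (mem_univ z)).trans h1
    rw [hr]
    have e : (∑ k, coordMarg k (zipLaw (c.inducedXY p)) z) / n - jointDist p q z =
        (∑ k : Fin n, (coordMarg k (zipLaw (c.inducedXY p)) z - jointDist p q z)) / n := by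
      rw [sum_sub_distrib, sum_const, card_univ, Fintype.card_fin, nsmul_eq_mul]
      field_simp
    rw [e, abs_div, abs_of_pos hn', div_le_iff₀ hn']
    refine (abs_sum_le_sum_abs _ _).trans ((sum_le_sum fun k _ => hk k).trans ?_)
    rw [sum_const, card_univ, Fintype.card_fin, nsmul_eq_mul, mul_comm]
  · rw [margXU_auxLaw hB, mutualInfo_compLaw hT.1 hA]
    have hpe : fstMarginal (compLaw (timeLaw n Q) fun u => coordMarg u.2 (α u.1)) = p := by
      funext x
      rw [fstMarginal_compLaw_timeLaw, hsα, hsfst]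
      simp only [coordMarg_iid hp, sum_const, card_univ, Fintype.card_fin, nsmul_eq_mul]
      field_simp
    rw [hpe]
    have h1 := sum_mul_ent_le_timeLaw (n := n) hQ.1 hα
    have h2 := div_le_div_of_nonneg_right hI1 hn'.le
    rw [sub_div, mul_div_cancel_left₀ _ hn'.ne'] at h2
    linarith
  · rw [auxLaw, mutualInfo_compLaw hT.1 fun u => prodLaw_mem (hA u) (hB u)]
    simp only [ent_prodLaw (hA _) (hB _), mul_add, sum_add_distrib]
    simp only [mul_add, sum_add_distrib] at hI2
    have h1 := sum_mul_ent_le_timeLaw (n := n) hQ.1 hα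
    have h1' := sum_mul_ent_le_timeLaw (n := n) hQ.1 hβ
    have h2 := div_le_div_of_nonneg_right (hfan.trans (add_le_add_left
      (show ent (c.inducedXY p) ≤ log M + log N + (∑ w, Q w * ent (α w) + ∑ w, Q w * ent (β w))
        by linarith) _)) hn'.le
    have e : (log M + log N + (∑ w, Q w * ent (α w) + ∑ w, Q w * ent (β w)) +
        (δ * (n * log (Fintype.card X * Fintype.card Y)) + negMulLog δ + δ)) / n =
        (log M + log N) / n + ((∑ w, Q w * ent (α w)) / n + (∑ w, Q w * ent (β w)) / n) +
        (δ * log (Fintype.card X * Fintype.card Y) + (negMulLog δ + δ) / n) := by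
      field_simp
      ring
    rw [e, mul_div_cancel_left₀ _ hn'.ne'] at h2
    linarith

lemma indexCount_ne_zero {n : ℕ} {R : ℝ} (hR : 0 ≤ R) : indexCount n R ≠ 0 := by
  refine (Nat.floor_pos.2 ?_).ne'
  exact one_le_rpow one_le_two (mul_nonneg n.cast_nonneg hR)

lemma log_indexCount_le {n : ℕ} {R : ℝ} (hR : 0 ≤ R) :
    log (indexCount n R) ≤ n * (R * log 2) := by
  have h0 : (0 : ℝ) < indexCount n R := by exact_mod_cast Nat.pos_of_ne_zero (indexCount_ne_zero hR)
  refine (log_le_log h0 (Nat.floor_le (by positivity))).trans_eq ?_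
  rw [log_rpow two_pos, mul_assoc]

theorem achievable_subset_rateSet {X Y : Type*} [Fintype X] [Fintype Y] {p : X → ℝ}
    (hp : p ∈ stdSimplex ℝ X) {q : X → Y → ℝ} (hq : ∀ x, q x ∈ stdSimplex ℝ Y) :
    {R | Achievable p q R} ⊆ rateSet p q := by
  rintro ⟨R₁, R₂⟩ ⟨h1, h2, c, hc⟩
  dsimp only at h1 h2
  -- Block lengths are shifted to `n + 1` so that division by the length is legitimate.
  have key : ∀ n : ℕ, _ := fun n => exists_auxDists_of_code hp hq n.succ_ne_zero
    (indexCount_ne_zero h1) (indexCount_ne_zero h2) (c (n + 1))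
  choose r t ht hr hI1 hI2 using key
  -- The auxiliary alphabets grow with the block length; a common finite alphabet is needed for the
  -- limit.
  choose t' ht' hI1' hI2' using fun n => exists_auxDists_card_le (ht n)
  set δ : ℕ → ℝ := fun n => tvDist ((c (n + 1)).inducedXY p) (iidDist p q (n + 1)) with hδ
  have hδ0 : Filter.Tendsto δ Filter.atTop (nhds 0) := hc.comp (Filter.tendsto_add_atTop_nat 1)
  have hrlim : Filter.Tendsto r Filter.atTop (nhds (jointDist p q)) := by
    rw [tendsto_pi_nhds]
    intro z
    rw [tendsto_iff_norm_sub_tendsto_zero]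
    refine squeeze_zero (fun _ => norm_nonneg _) (fun n => hr n z) ?_
    simpa using hδ0.const_mul 2
  have hinv : Filter.Tendsto (fun n : ℕ => (1 : ℝ) / ((n : ℝ) + 1)) Filter.atTop (nhds 0) :=
    tendsto_one_div_add_atTop_nhds_zero_nat
  let ε : ℕ → ℝ := fun n => ent (r n) - ent (jointDist p q)
    + δ n * log (Fintype.card X * Fintype.card Y)
    + (negMulLog (δ n) + δ n) * (1 / ((n : ℝ) + 1))
  have hε : Filter.Tendsto ε Filter.atTop (nhds 0) := by
    have e1 := ((continuous_ent.tendsto _).comp hrlim).sub_const (ent (jointDist p q))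
    have e2 := hδ0.mul_const (log (Fintype.card X * Fintype.card Y))
    have e3 := (((continuous_negMulLog.tendsto 0).comp hδ0).add hδ0).mul hinv
    simpa [ε] using (e1.add e2).add e3
  have hb : Filter.Tendsto (fun n => R₁ + R₂ + ε n / log 2) Filter.atTop (nhds (R₁ + R₂)) := by
    simpa using (hε.div_const (log 2)).const_add (R₁ + R₂)
  have hlog : ∀ (n : ℕ) {R : ℝ}, 0 ≤ R → log (indexCount (n + 1) R) / ((n + 1 : ℕ) : ℝ) ≤
      R * log 2 := by
    intro n R hR
    rw [div_le_iff₀ (by positivity), mul_comm]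
    exact log_indexCount_le hR
  obtain ⟨t₀, ht₀, ha₀, hb₀⟩ := exists_auxDists_of_tendsto ht' hrlim
    (tendsto_const_nhds (x := R₁)) hb
    (fun n => (hI1' n).trans (le_of_mul_le_mul_right ((hI1 n).trans (hlog n h1)) log_two_pos))
    (fun n => (hI2' n).trans (le_of_mul_le_mul_right ((hI2 n).trans (by
      have l1 := hlog n h1
      have l2 := hlog n h2
      rw [add_mul, div_mul_cancel₀ _ log_two_pos.ne', add_mul, add_div (log _)]
      simp only [ε, mul_one_div]
      push_cast at l1 l2 ⊢
      linarith)) log_two_pos))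
  exact ⟨h2, _, le_rfl, t₀, ht₀, ha₀, hb₀⟩

/-! ### Soft covering -/

lemma sum_iid_mul_sum_sq {ι U : Type*} [Fintype ι] [DecidableEq ι] [Fintype U] {Q : U → ℝ}
    (hQ : Q ∈ stdSimplex ℝ U) {g : U → ℝ} (hg : ∑ u, Q u * g u = 0) (s : Finset ι) :
    ∑ c : ι → U, iid Q c * (∑ i ∈ s, g (c i)) ^ 2 = s.card * ∑ u, Q u * g u ^ 2 := by
  simp only [sq, sum_mul_sum]
  rw [← nsmul_eq_mul, ← sum_const]
  simp only [mul_sum (s := s)]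
  rw [sum_comm]
  refine sum_congr rfl fun i hi => ?_
  rw [sum_comm, sum_eq_single_of_mem i hi]
  · exact sum_iid_mul_apply hQ (fun u => g u * g u) i
  · intro j _ hji
    rw [sum_iid_mul_apply_mul_apply hQ g g hji.symm, hg, zero_mul]

lemma sum_mul_abs_le_of_sq {α : Type*} [Fintype α] {w f : α → ℝ} (hw : w ∈ stdSimplex ℝ α)
    {b : ℝ} (hb : 0 ≤ b) (h : ∑ a, w a * f a ^ 2 ≤ b ^ 2) : ∑ a, w a * |f a| ≤ b := by
  refine (le_abs_self _).trans (abs_le_of_sq_le_sq (le_trans ?_ h) hb)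
  have := (even_two.convexOn_pow (𝕜 := ℝ)).map_sum_le (t := univ) (w := w) (p := fun a => |f a|)
    (fun a _ => hw.1 a) hw.2 fun _ _ => Set.mem_univ _
  simpa [smul_eq_mul, sq_abs] using this

/-- The part `K₁` with controlled second moment is handled by its variance, the remainder `K₂` by
the triangle inequality, which costs its mean twice. -/
lemma sum_iid_mul_abs_avg_le {ι U : Type*} [Fintype ι] [DecidableEq ι] [Fintype U] {Q : U → ℝ}
    (hQ : Q ∈ stdSimplex ℝ U) {K₁ K₂ : U → ℝ} (hK₂ : ∀ u, 0 ≤ K₂ u) {s : Finset ι}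
    (hs : s.Nonempty) {o₁ o₂ v : ℝ} (ho₁ : ∑ u, Q u * K₁ u = o₁) (ho₂ : ∑ u, Q u * K₂ u = o₂)
    (hv : ∑ u, Q u * K₁ u ^ 2 ≤ v) :
    ∑ c : ι → U, iid Q c * |(∑ i ∈ s, (K₁ (c i) + K₂ (c i))) / s.card - (o₁ + o₂)| ≤
      2 * o₂ + √(v / s.card) := by
  have hm : (0 : ℝ) < s.card := by exact_mod_cast hs.card_pos
  have ho₂' : 0 ≤ o₂ := ho₂ ▸ sum_nonneg fun u _ => mul_nonneg (hQ.1 u) (hK₂ u)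
  have hv0 : 0 ≤ v := le_trans (sum_nonneg fun u _ => mul_nonneg (hQ.1 u) (sq_nonneg _)) hv
  have hiid := iid_mem (ι := ι) hQ
  have hpt : ∀ c : ι → U, |(∑ i ∈ s, (K₁ (c i) + K₂ (c i))) / s.card - (o₁ + o₂)| ≤
      |∑ i ∈ s, (K₁ (c i) - o₁)| / s.card + (∑ i ∈ s, K₂ (c i)) / s.card + o₂ := by
    intro c
    have e : (∑ i ∈ s, (K₁ (c i) + K₂ (c i))) / s.card - (o₁ + o₂) =
        (∑ i ∈ s, (K₁ (c i) - o₁)) / s.card + (∑ i ∈ s, K₂ (c i)) / s.card - o₂ := by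
      rw [sum_sub_distrib, sum_const, nsmul_eq_mul, sum_add_distrib]
      field_simp
      ring
    rw [e]
    refine (abs_sub _ _).trans (add_le_add ((abs_add_le _ _).trans (add_le_add ?_ ?_)) ?_)
    · rw [abs_div, abs_of_pos hm]
    · rw [abs_of_nonneg (div_nonneg (sum_nonneg fun i _ => hK₂ _) hm.le)]
    · rw [abs_of_nonneg ho₂']
  have h2 : ∑ c : ι → U, iid Q c * ((∑ i ∈ s, K₂ (c i)) / s.card) = o₂ := by
    simp only [← mul_div_assoc, mul_sum]
    rw [← sum_div, sum_comm]
    simp only [sum_iid_mul_apply hQ K₂, ho₂, sum_const, nsmul_eq_mul]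
    field_simp
  have h1 : ∑ c : ι → U, iid Q c * |∑ i ∈ s, (K₁ (c i) - o₁)| ≤ s.card * √(v / s.card) := by
    refine sum_mul_abs_le_of_sq hiid (by positivity) ?_
    have hg : ∑ u, Q u * (K₁ u - o₁) = 0 := by
      simp only [mul_sub, sum_sub_distrib, ← sum_mul, hQ.2, ho₁]
      ring
    rw [sum_iid_mul_sum_sq hQ (g := fun u => K₁ u - o₁) hg]
    have hvar : ∑ u, Q u * (K₁ u - o₁) ^ 2 ≤ v := by
      have e : ∀ u, Q u * (K₁ u - o₁) ^ 2 =
          Q u * K₁ u ^ 2 - 2 * o₁ * (Q u * K₁ u) + Q u * o₁ ^ 2 := fun u => by ring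
      simp only [e, sum_add_distrib, sum_sub_distrib, ← mul_sum, ← sum_mul, hQ.2, ho₁]
      linarith [sq_nonneg o₁]
    calc (s.card : ℝ) * ∑ u, Q u * (K₁ u - o₁) ^ 2 ≤ s.card * v := by gcongr
      _ = _ := by
        rw [mul_pow, sq_sqrt (by positivity)]
        field_simp
  calc _ ≤ ∑ c : ι → U, iid Q c * (|∑ i ∈ s, (K₁ (c i) - o₁)| / s.card
          + (∑ i ∈ s, K₂ (c i)) / s.card + o₂) :=
        sum_le_sum fun c _ => mul_le_mul_of_nonneg_left (hpt c) (hiid.1 c)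
    _ = (∑ c : ι → U, iid Q c * |∑ i ∈ s, (K₁ (c i) - o₁)|) / s.card + o₂ + o₂ := by
        simp only [mul_add, sum_add_distrib, h2, ← sum_mul, hiid.2, one_mul]
        simp only [← mul_div_assoc, ← sum_div]
    _ ≤ √(v / s.card) + o₂ + o₂ := by
        gcongr
        rw [div_le_iff₀ hm]
        linarith
    _ = _ := by ring

/-- Truncation at `τ * o` makes the second moment of the kept part at most `τ * o ^ 2`, so its
deviation is proportional to `o` and can be summed over outputs. -/
lemma sum_iid_mul_abs_le {ι U : Type*} [Fintype ι] [DecidableEq ι] [Fintype U] {Q : U → ℝ}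
    (hQ : Q ∈ stdSimplex ℝ U) {K : U → ℝ} (hK : ∀ u, 0 ≤ K u) {s : Finset ι} (hs : s.Nonempty)
    {τ o : ℝ} (hτ : 0 ≤ τ) (ho : ∑ u, Q u * K u = o) :
    ∑ c : ι → U, iid Q c * |(∑ i ∈ s, K (c i)) / s.card - o| ≤
      2 * ∑ u, Q u * (if τ * o < K u then K u else 0) + √(τ / s.card) * o := by
  have ho0 : 0 ≤ o := ho ▸ sum_nonneg fun u _ => mul_nonneg (hQ.1 u) (hK u)
  have hsplit : ∀ u, (if τ * o < K u then 0 else K u) + (if τ * o < K u then K u else 0) = K u :=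
    fun u => by split_ifs <;> simp
  have hsq : ∀ u, (if τ * o < K u then 0 else K u) ^ 2 ≤ τ * o * K u := by
    intro u
    split_ifs with h
    · simpa using mul_nonneg (mul_nonneg hτ ho0) (hK u)
    · rw [sq]
      exact mul_le_mul_of_nonneg_right (not_lt.1 h) (hK u)
  have key := sum_iid_mul_abs_avg_le hQ (K₁ := fun u => if τ * o < K u then 0 else K u)
    (K₂ := fun u => if τ * o < K u then K u else 0)
    (fun u => by split_ifs; exacts [hK u, le_rfl]) hs rfl rfl (v := τ * o ^ 2) (by
      calc _ ≤ ∑ u, τ * o * (Q u * K u) := sum_le_sum fun u _ => by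
            have := mul_le_mul_of_nonneg_left (hsq u) (hQ.1 u)
            linarith
        _ = τ * o ^ 2 := by rw [← mul_sum, ho]; ring)
  rw [← sum_add_distrib] at key
  simp only [← mul_add, hsplit, ho] at key
  rwa [mul_div_right_comm, sqrt_mul (by positivity), sqrt_sq ho0] at key

/-- One-shot soft covering: the output law of a channel `W` driven by a random codebook, restricted
to the codewords in `s`, approximates the law of the output. -/
lemma softCovering {ι U Z : Type*} [Fintype ι] [DecidableEq ι] [Fintype U] [Fintype Z] {Q : U → ℝ}
    (hQ : Q ∈ stdSimplex ℝ U) {W : U → Z → ℝ} (hW : ∀ u, W u ∈ stdSimplex ℝ Z) {s : Finset ι}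
    (hs : s.Nonempty) {τ : ℝ} (hτ : 0 ≤ τ) :
    ∑ c : ι → U, iid Q c *
        ∑ z, |(∑ i ∈ s, W (c i) z) / s.card - fstMarginal (compLaw Q W) z| ≤
      2 * ∑ z, ∑ u, Q u * (if τ * fstMarginal (compLaw Q W) z < W u z then W u z else 0)
        + √(τ / s.card) := by
  simp only [mul_sum (s := (univ : Finset Z)) _ (iid Q _)]
  rw [sum_comm]
  calc _ ≤ ∑ z, (2 * ∑ u, Q u * (if τ * fstMarginal (compLaw Q W) z < W u z then W u z else 0)
          + √(τ / s.card) * fstMarginal (compLaw Q W) z) :=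
        sum_le_sum fun z _ => sum_iid_mul_abs_le hQ (fun u => (hW u).1 z) hs hτ rfl
    _ = _ := by
        rw [sum_add_distrib, ← mul_sum, ← mul_sum, (fstMarginal_mem (compLaw_mem hQ hW)).2, mul_one]

/-! ### Exponential tails and memoryless channels -/

/-- Chernoff bound. -/
lemma exists_chernoff {A : Type*} [Fintype A] {P : A → ℝ} (hP : P ∈ stdSimplex ℝ A) {f : A → ℝ}
    {τ : ℝ} (hf : ∑ a, P a * f a < τ) :
    ∃ ρ : ℝ, 0 ≤ ρ ∧ ρ < 1 ∧ ∀ n : ℕ,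
      ∑ v : Fin n → A, (if n * τ < ∑ k, f (v k) then iid P v else 0) ≤ ρ ^ n := by
  -- The exponential moment has `G 0 = 1` and negative derivative at `0`, so it drops below `1` at
  -- some `x > 0`; that value is `ρ`.
  let G : ℝ → ℝ := fun x => ∑ a, P a * exp (x * (f a - τ))
  have hG0 : G 0 = 1 := by simp [G, hP.2]
  have hG' : HasDerivAt G (∑ a, P a * (f a - τ)) 0 := by
    refine HasDerivAt.fun_sum fun a _ => ?_
    have := (((hasDerivAt_id (0 : ℝ)).mul_const (f a - τ)).exp).const_mul (P a)
    simpa using this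
  have hneg : ∑ a, P a * (f a - τ) < 0 := by
    simp only [mul_sub, sum_sub_distrib, ← sum_mul, hP.2]
    linarith
  obtain ⟨x, hx0, hx1⟩ : ∃ x, 0 < x ∧ G x < 1 := by
    have h1 := (hasDerivAt_iff_tendsto_slope_zero.1 hG').mono_left
      (nhdsWithin_mono 0 (fun x (hx : x ∈ Set.Ioi (0 : ℝ)) => ne_of_gt hx))
    obtain ⟨x, hx, hx0⟩ :=
      ((h1.eventually (gt_mem_nhds hneg)).and self_mem_nhdsWithin).exists
    refine ⟨x, hx0, ?_⟩
    simp only [zero_add, smul_eq_mul, hG0] at hx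
    have hx0' : 0 < x := hx0
    have : G x - 1 < 0 := by
      by_contra! hc
      exact absurd hx (not_lt.2 (mul_nonneg (inv_nonneg.2 hx0'.le) hc))
    linarith
  refine ⟨G x, sum_nonneg fun a _ => mul_nonneg (hP.1 a) (exp_pos _).le, hx1, fun n => ?_⟩
  calc _ ≤ ∑ v : Fin n → A, ∏ k, P (v k) * exp (x * (f (v k) - τ)) := by
        refine sum_le_sum fun v _ => ?_
        have hnn : 0 ≤ iid P v := (iid_mem hP).1 v
        rw [prod_mul_distrib, ← exp_sum, ← mul_sum, sum_sub_distrib, sum_const, card_univ,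
          Fintype.card_fin, nsmul_eq_mul]
        split_ifs with h
        · refine le_mul_of_one_le_right hnn (one_le_exp (mul_nonneg hx0.le ?_))
          linarith
        · exact mul_nonneg hnn (exp_pos _).le
    _ = G x ^ n := by
        rw [sum_prod_apply fun (_ : Fin n) a => P a * exp (x * (f a - τ))]
        simp [G]

/-- The memoryless extension of a channel. -/
def memoryless {ι U Z : Type*} [Fintype ι] (W : U → Z → ℝ) : (ι → U) → (ι → Z) → ℝ :=
  fun u z => ∏ k, W (u k) (z k)

section memoryless

variable {ι U Z : Type*} [Fintype ι] [DecidableEq ι]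

lemma memoryless_mem [Fintype Z] {W : U → Z → ℝ} (hW : ∀ u, W u ∈ stdSimplex ℝ Z) (u : ι → U) :
    memoryless W u ∈ stdSimplex ℝ (ι → Z) := by
  refine ⟨fun z => prod_nonneg fun k _ => (hW _).1 _, ?_⟩
  simp only [memoryless]
  rw [sum_prod_apply fun k => W (u k)]
  simp [(hW _).2]

lemma fstMarginal_compLaw_memoryless [Fintype U] (Q : U → ℝ) (W : U → Z → ℝ) :
    fstMarginal (compLaw (iid Q) (memoryless (ι := ι) W)) = iid (fstMarginal (compLaw Q W)) := by
  funext z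
  simp only [fstMarginal, compLaw, iid, memoryless, ← prod_mul_distrib]
  exact sum_prod_apply fun k u => Q u * W u (z k)

end memoryless

/-- Taking logarithms, an atypical pair is one whose information density, a sum of i.i.d. terms,
exceeds `n * τ`; this prepares for `exists_chernoff`. -/
lemma sum_atypical_le {U Z : Type*} [Fintype U] [Fintype Z] {Q : U → ℝ}
    (hQ : Q ∈ stdSimplex ℝ U) {W : U → Z → ℝ} (hW : ∀ u, W u ∈ stdSimplex ℝ Z) (n : ℕ) (τ : ℝ) :
    ∑ z : Fin n → Z, ∑ u : Fin n → U, iid Q u *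
        (if exp (n * τ) * iid (fstMarginal (compLaw Q W)) z < memoryless W u z then
          memoryless W u z else 0) ≤
      ∑ v : Fin n → Z × U, if n * τ < ∑ k, (log (W (v k).2 (v k).1)
        - log (fstMarginal (compLaw Q W) (v k).1)) then iid (compLaw Q W) v else 0 := by
  have h0 := compLaw_nonneg hQ.1 hW
  rw [← Fintype.sum_prod_type', ← sum_zipLaw]
  refine sum_le_sum fun v _ => ?_
  simp only [zipLaw]
  have e : iid Q (fun k => (v k).2) * memoryless W (fun k => (v k).2) (fun k => (v k).1) =
      iid (compLaw Q W) v := by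
    simp only [iid, memoryless, compLaw, prod_mul_distrib]
  have hnn : 0 ≤ iid (compLaw Q W) v := prod_nonneg fun k _ => h0 _
  rw [mul_ite, mul_zero, e]
  rcases hnn.eq_or_lt with hz | hpos
  · simp [← hz]
  by_cases hlt : exp (n * τ) * iid (fstMarginal (compLaw Q W)) (fun k => (v k).1) <
      memoryless W (fun k => (v k).2) (fun k => (v k).1)
  · rw [if_pos hlt, if_pos]
    have hk : ∀ k, 0 < compLaw Q W (v k) := fun k => lt_of_le_of_ne (h0 _) fun h =>
      hpos.ne' (prod_eq_zero (mem_univ k) h.symm)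
    have hWk : ∀ k, 0 < W (v k).2 (v k).1 := fun k =>
      lt_of_le_of_ne ((hW _).1 _) fun h => (hk k).ne' (by simp [compLaw, ← h])
    have hok : ∀ k, 0 < fstMarginal (compLaw Q W) (v k).1 := fun k =>
      (hk k).trans_le (le_fstMarginal h0 _ _)
    have hpo : 0 < iid (fstMarginal (compLaw Q W)) (fun k => (v k).1) :=
      prod_pos fun k _ => hok k
    have := log_lt_log (mul_pos (exp_pos _) hpo) hlt
    rw [log_mul (exp_pos _).ne' hpo.ne', log_exp, iid, memoryless,
      log_prod fun k _ => (hok k).ne', log_prod fun k _ => (hWk k).ne'] at this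
    rw [sum_sub_distrib]
    linarith
  · rw [if_neg hlt]
    split_ifs
    exacts [hnn, le_rfl]

/-- Soft covering for memoryless channels at any rate above the mutual information. -/
theorem exists_softCovering_bound {U Z : Type*} [Fintype U] [Fintype Z] {Q : U → ℝ}
    (hQ : Q ∈ stdSimplex ℝ U) {W : U → Z → ℝ} (hW : ∀ u, W u ∈ stdSimplex ℝ Z) {R : ℝ}
    (hR : mutualInfo (compLaw Q W) < R) :
    ∃ ε : ℕ → ℝ, Filter.Tendsto ε Filter.atTop (nhds 0) ∧
      ∀ (n : ℕ) {ι : Type} [Fintype ι] [DecidableEq ι] (s : Finset ι),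
        (2 : ℝ) ^ ((n : ℝ) * R) / 4 ≤ s.card →
        ∑ c : ι → Fin n → U, iid (iid Q) c * ∑ z : Fin n → Z,
          |(∑ i ∈ s, memoryless W (c i) z) / s.card - iid (fstMarginal (compLaw Q W)) z| ≤ ε n := by
  have h0 := compLaw_nonneg hQ.1 hW
  -- A threshold strictly between the information and the rate, in nats: the lower gap makes the
  -- atypical mass decay, the upper gap makes the variance term decay like `η ^ n`.
  obtain ⟨τ, hτ1, hτ2⟩ := exists_between (mul_lt_mul_of_pos_right hR log_two_pos)
  have hmean : ∑ z : Z × U, compLaw Q W z * (log (W z.2 z.1) - log (fstMarginal (compLaw Q W) z.1))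
      < τ := by
    refine lt_of_eq_of_lt ?_ hτ1
    rw [mutualInfo_mul_log_two h0, sndMarginal_compLaw hW]
    refine sum_congr rfl fun z _ => ?_
    by_cases hz : compLaw Q W z = 0
    · simp [hz]
    · have hz' := mul_ne_zero_iff.1 hz
      have : log (compLaw Q W z) = log (Q z.2) + log (W z.2 z.1) := log_mul hz'.1 hz'.2
      rw [this]
      ring
  obtain ⟨ρ, hρ0, hρ1, hρ⟩ := exists_chernoff (compLaw_mem hQ hW) hmean
  set η := exp (τ - R * log 2) with hη
  have hη1 : η < 1 := by rw [hη, exp_lt_one_iff]; linarith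
  refine ⟨fun n => 2 * ρ ^ n + √(4 * η ^ n), ?_, ?_⟩
  · have e1 := (tendsto_pow_atTop_nhds_zero_of_lt_one hρ0 hρ1).const_mul 2
    have e2 := ((tendsto_pow_atTop_nhds_zero_of_lt_one (exp_pos _).le hη1).const_mul 4).sqrt
    simpa using e1.add e2
  · intro n ι _ _ s hs
    have hpow : (0 : ℝ) < 2 ^ ((n : ℝ) * R) := by positivity
    have hm : (0 : ℝ) < s.card := lt_of_lt_of_le (by positivity) hs
    have hne : s.Nonempty := card_pos.1 (by exact_mod_cast hm)
    have key := softCovering (iid_mem (ι := Fin n) hQ) (memoryless_mem hW) hne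
      (exp_pos (n * τ)).le
    rw [fstMarginal_compLaw_memoryless] at key
    refine key.trans (add_le_add ?_ (sqrt_le_sqrt ?_))
    · exact mul_le_mul_of_nonneg_left ((sum_atypical_le hQ hW n τ).trans (hρ n)) two_pos.le
    · rw [div_le_iff₀ hm]
      have e : η ^ n * 2 ^ ((n : ℝ) * R) = exp (n * τ) := by
        rw [hη, ← exp_nat_mul, rpow_def_of_pos two_pos, ← exp_add]
        congr 1
        ring
      have : 0 ≤ η ^ n := by positivity
      nlinarith [mul_le_mul_of_nonneg_left hs this]

/-! ### Achievability -/

/-- The posterior law of `i` given the weights `a`, uniform if all weights vanish. -/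
def posterior {M : ℕ} (a : Fin M → ℝ) : Fin M → ℝ :=
  open Classical in if ∑ i, a i = 0 then fun _ => 1 / M else fun i => a i / ∑ i, a i

lemma posterior_mem {M : ℕ} (hM : M ≠ 0) {a : Fin M → ℝ} (ha : ∀ i, 0 ≤ a i) :
    posterior a ∈ stdSimplex ℝ (Fin M) := by
  have hM' : (M : ℝ) ≠ 0 := by exact_mod_cast hM
  unfold posterior
  split_ifs with h
  · exact ⟨fun i => by positivity, by simp [hM']⟩
  · exact ⟨fun i => div_nonneg (ha i) (sum_nonneg fun i _ => ha i), by
      rw [← sum_div, div_self h]⟩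

lemma sum_mul_posterior {M : ℕ} {a : Fin M → ℝ} (ha : ∀ i, 0 ≤ a i) (i : Fin M) :
    (∑ i, a i) * posterior a i = a i := by
  unfold posterior
  split_ifs with h
  · rw [h, zero_mul, (sum_eq_zero_iff_of_nonneg fun i _ => ha i).1 h i (mem_univ i)]
  · exact mul_div_cancel₀ _ h

/-- In the ideal law, `(i,j)` is uniform and drives `A` and `B`. Its conditional law of `i` given
`(x,j)` is the encoder, so the code departs from it only through the law of `(x,j)`. The two error
terms compare the ideal law with the target and correct that marginal. -/
lemma exists_code_of_codebook {X Y : Type*} [Fintype X] [Fintype Y] (p : X → ℝ) (q : X → Y → ℝ)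
    {n M N : ℕ} (hM : M ≠ 0) (hN : N ≠ 0) {A : Fin M × Fin N → (Fin n → X) → ℝ}
    {B : Fin M × Fin N → (Fin n → Y) → ℝ} (hA : ∀ w, A w ∈ stdSimplex ℝ (Fin n → X))
    (hB : ∀ w, B w ∈ stdSimplex ℝ (Fin n → Y)) :
    ∃ c : Code X Y n M N, 2 * tvDist (c.inducedXY p) (iidDist p q n) ≤
      ∑ z, |(∑ w, prodLaw (A w) (B w) z) / (M * N) - iidDist p q n z| +
        (∑ j, ∑ x, |(∑ i, A (i, j) x) / M - iid p x|) / N := by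
  have hM' : (0 : ℝ) < M := by exact_mod_cast Nat.pos_of_ne_zero hM
  have hN' : (0 : ℝ) < N := by exact_mod_cast Nat.pos_of_ne_zero hN
  let c : Code X Y n M N :=
    { enc := fun x j => posterior fun i => A (i, j) x
      dec := fun i j => B (i, j)
      enc_mem := fun x j => posterior_mem hM fun i => (hA _).1 _
      dec_mem := fun i j => hB _ }
  refine ⟨c, ?_⟩
  have hpt : ∀ z, |c.inducedXY p z - iidDist p q n z| ≤
      |(∑ w, prodLaw (A w) (B w) z) / (M * N) - iidDist p q n z| +
        ∑ i, ∑ j, |(∑ i, A (i, j) z.1) / M - iid p z.1| * c.enc z.1 j i * B (i, j) z.2 / N := by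
    intro z
    have e : c.inducedXY p z - (∑ w, prodLaw (A w) (B w) z) / (M * N) =
        ∑ i, ∑ j, (iid p z.1 - (∑ i, A (i, j) z.1) / M) * c.enc z.1 j i * B (i, j) z.2 / N := by
      rw [Code.inducedXY, Fintype.sum_prod_type, sum_div, ← sum_sub_distrib]
      refine sum_congr rfl fun i _ => ?_
      rw [sum_div, ← sum_sub_distrib]
      refine sum_congr rfl fun j _ => ?_
      have h := sum_mul_posterior (a := fun i => A (i, j) z.1) (fun i => (hA _).1 _) i
      have hd : c.induced p z.1 z.2 i j = 1 / N * iid p z.1 * c.enc z.1 j i * B (i, j) z.2 := rfl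
      have he : c.enc z.1 j i = posterior (fun i => A (i, j) z.1) i := rfl
      rw [hd, prodLaw, he]
      rw [← h]
      field_simp
    have h1 : |c.inducedXY p z - (∑ w, prodLaw (A w) (B w) z) / (M * N)| ≤
        ∑ i, ∑ j, |(∑ i, A (i, j) z.1) / M - iid p z.1| * c.enc z.1 j i * B (i, j) z.2 / N := by
      rw [e]
      refine (abs_sum_le_sum_abs _ _).trans (sum_le_sum fun i _ =>
        (abs_sum_le_sum_abs _ _).trans (sum_le_sum fun j _ => le_of_eq ?_))
      rw [abs_div, abs_mul, abs_mul, abs_of_pos hN', abs_of_nonneg ((hB _).1 _),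
        abs_of_nonneg ((c.enc_mem _ _).1 _), abs_sub_comm]
    have h2 := abs_sub_le (c.inducedXY p z) ((∑ w, prodLaw (A w) (B w) z) / (M * N))
      (iidDist p q n z)
    linarith
  calc 2 * tvDist (c.inducedXY p) (iidDist p q n)
      = ∑ z, |c.inducedXY p z - iidDist p q n z| := by rw [tvDist]; ring
    _ ≤ _ := sum_le_sum fun z _ => hpt z
    _ = _ := by
      rw [sum_add_distrib]
      congr 1
      rw [Fintype.sum_prod_type, sum_div]
      have e1 : ∀ x, ∑ y : Fin n → Y, ∑ i, ∑ j,
          |(∑ i, A (i, j) x) / M - iid p x| * c.enc x j i * B (i, j) y / N =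
          ∑ j, |(∑ i, A (i, j) x) / M - iid p x| / N := by
        intro x
        rw [sum_comm]
        have e2 : ∀ i, ∑ y : Fin n → Y, ∑ j,
            |(∑ i, A (i, j) x) / M - iid p x| * c.enc x j i * B (i, j) y / N =
            ∑ j, |(∑ i, A (i, j) x) / M - iid p x| / N * c.enc x j i := by
          intro i
          rw [sum_comm]
          refine sum_congr rfl fun j _ => ?_
          rw [← sum_div, ← mul_sum, (hB _).2]
          ring
        simp only [e2]
        rw [sum_comm]
        refine sum_congr rfl fun j _ => ?_
        rw [← mul_sum, (c.enc_mem x j).2, mul_one]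
      simp only [e1]
      rw [sum_comm]
      simp only [sum_div]

lemma exists_le_of_sum_mul_le {α : Type*} [Fintype α] {w f : α → ℝ} (hw : w ∈ stdSimplex ℝ α)
    {b : ℝ} (h : ∑ a, w a * f a ≤ b) : ∃ a, f a ≤ b := by
  by_contra! hc
  have h1 : ∑ a, w a * (f a - b) ≤ 0 := by
    simp only [mul_sub, sum_sub_distrib, ← sum_mul, hw.2]
    linarith
  have h2 : ∀ a ∈ univ, 0 ≤ w a * (f a - b) := fun a _ =>
    mul_nonneg (hw.1 a) (sub_nonneg.2 (hc a).le)
  have h3 := (sum_eq_zero_iff_of_nonneg h2).1 (le_antisymm h1 (sum_nonneg h2))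
  have h4 : ∑ a, w a = 0 := sum_eq_zero fun a ha =>
    (mul_eq_zero.1 (h3 a ha)).resolve_right (sub_pos.2 (hc a)).ne'
  linarith [hw.2]

/-- Rounding loses at most a factor 2 per index, hence at most 4 for the pair, as allowed in
`exists_softCovering_bound`. -/
lemma half_le_indexCount {n : ℕ} {R : ℝ} (hR : 0 ≤ R) :
    (2 : ℝ) ^ ((n : ℝ) * R) / 2 ≤ indexCount n R := by
  have h1 : (1 : ℝ) ≤ indexCount n R := by
    exact_mod_cast Nat.one_le_iff_ne_zero.2 (indexCount_ne_zero hR)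
  have h2 : (2 : ℝ) ^ ((n : ℝ) * R) < indexCount n R + 1 := Nat.lt_floor_add_one _
  linarith

/-- One random codebook has to meet all covering demands at once. The covering errors are averaged
over the same codebook law, so some codebook does no worse than the average of their sum. -/
theorem achievable_of_auxDists {X Y U : Type*} [Fintype X] [Fintype Y] [Fintype U] {p : X → ℝ}
    {q : X → Y → ℝ} (hq : ∀ x, q x ∈ stdSimplex ℝ Y) {R₁ R₂ : ℝ} (h1 : 0 ≤ R₁) (h2 : 0 ≤ R₂)
    {t : (X × Y) × U → ℝ} (ht : t ∈ auxDists (jointDist p q) U) (hI1 : mutualInfo (margXU t) < R₁)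
    (hI2 : mutualInfo t < R₁ + R₂) : Achievable p q (R₁, R₂) := by
  obtain ⟨Q, hQ, A, B, hA, hB, rfl⟩ := exists_eq_auxLaw ht
  obtain ⟨-, hfst, -⟩ := ht
  have hAB : ∀ u, prodLaw (A u) (B u) ∈ stdSimplex ℝ (X × Y) := fun u => prodLaw_mem (hA u) (hB u)
  have hfstX : fstMarginal (compLaw Q A) = p := by
    rw [← margXU_auxLaw hB, fstMarginal_margXU, hfst]
    funext x
    simp [fstMarginal, jointDist, ← mul_sum, (hq x).2]
  rw [margXU_auxLaw hB] at hI1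
  obtain ⟨ε₁, hε₁, hb₁⟩ := exists_softCovering_bound hQ hA hI1
  obtain ⟨ε₂, hε₂, hb₂⟩ := exists_softCovering_bound hQ hAB hI2
  rw [hfstX] at hb₁
  change fstMarginal (compLaw Q fun u => prodLaw (A u) (B u)) = _ at hfst
  rw [hfst] at hb₂
  have key : ∀ n : ℕ, ∃ c : Code X Y n (indexCount n R₁) (indexCount n R₂),
      2 * tvDist (c.inducedXY p) (iidDist p q n) ≤ ε₂ n + ε₁ n := by
    intro n
    have hM := indexCount_ne_zero (n := n) h1
    have hN := indexCount_ne_zero (n := n) h2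
    have hMl := half_le_indexCount (n := n) h1
    have hNl := half_le_indexCount (n := n) h2
    set M := indexCount n R₁
    set N := indexCount n R₂
    have hN' : (0 : ℝ) < N := by exact_mod_cast Nat.pos_of_ne_zero hN
    have hcov₂ := hb₂ n (univ : Finset (Fin M × Fin N)) (by
      rw [card_univ, Fintype.card_prod, Fintype.card_fin, Fintype.card_fin, Nat.cast_mul, mul_add,
        rpow_add two_pos]
      have := mul_le_mul hMl hNl (by positivity) (by positivity)
      linarith)
    -- The slice of codewords sharing the common index `j`.
    have hcov₁ : ∀ j : Fin N, _ := fun j =>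
      hb₁ n ((univ : Finset (Fin M)) ×ˢ ({j} : Finset (Fin N))) (by
        rw [card_product, card_singleton, mul_one, card_univ, Fintype.card_fin]
        have : (0 : ℝ) < 2 ^ ((n : ℝ) * R₁) := by positivity
        linarith)
    simp only [sum_product, sum_singleton, card_product, card_singleton, mul_one, card_univ,
      Fintype.card_fin] at hcov₁
    rw [card_univ, Fintype.card_prod, Fintype.card_fin, Fintype.card_fin, Nat.cast_mul] at hcov₂
    let F₁ : (Fin M × Fin N → Fin n → U) → ℝ := fun c =>
      (∑ j, ∑ x, |(∑ i, memoryless A (c (i, j)) x) / M - iid p x|) / N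
    let F₂ : (Fin M × Fin N → Fin n → U) → ℝ := fun c =>
      ∑ z, |(∑ w, prodLaw (memoryless A (c w)) (memoryless B (c w)) z) / (M * N)
        - iidDist p q n z|
    have hF₁ : ∑ c, iid (iid Q) c * F₁ c ≤ ε₁ n := by
      simp only [F₁, ← mul_div_assoc, mul_sum (s := (univ : Finset (Fin N)))]
      rw [← sum_div, div_le_iff₀ hN', sum_comm]
      refine (sum_le_sum fun j _ => hcov₁ j).trans_eq ?_
      rw [sum_const, card_univ, Fintype.card_fin, nsmul_eq_mul, mul_comm]
    have hF₂ : ∑ c, iid (iid Q) c * F₂ c ≤ ε₂ n := by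
      refine le_of_eq_of_le (sum_congr rfl fun c _ => ?_) hcov₂
      congr 1
      simp only [F₂]
      rw [← sum_zipLaw]
      refine sum_congr rfl fun v _ => ?_
      simp only [zipLaw, prodLaw, memoryless, prod_mul_distrib]
      rfl
    obtain ⟨c, hc⟩ := exists_le_of_sum_mul_le (f := fun c => F₂ c + F₁ c) (iid_mem (iid_mem hQ))
      (show _ ≤ ε₂ n + ε₁ n by
        simp only [mul_add, sum_add_distrib]
        exact add_le_add hF₂ hF₁)
    obtain ⟨code, hcode⟩ := exists_code_of_codebook p q hM hN
      (fun w => memoryless_mem hA (c w)) (fun w => memoryless_mem hB (c w))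
    exact ⟨code, hcode.trans hc⟩
  choose c hc using key
  refine ⟨h1, h2, c, squeeze_zero (g := fun n => (ε₂ n + ε₁ n) / 2) (fun n => ?_) (fun n => ?_) ?_⟩
  · exact mul_nonneg (by norm_num) (sum_nonneg fun _ _ => abs_nonneg _)
  · linarith [hc n]
  · simpa using (hε₂.add hε₁).div_const 2

/-! ### The rate region and its extreme points -/

lemma mutualInfo_nonneg {α β : Type*} [Fintype α] [Fintype β] {r : α × β → ℝ}
    (hr : r ∈ stdSimplex ℝ (α × β)) : 0 ≤ mutualInfo r := by
  refine nonneg_of_mul_nonneg_left ?_ log_two_pos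
  rw [mutualInfo_mul_log_two hr.1]
  have hg := sum_mul_log_sub_log_nonneg (P := r)
    (Q := prodLaw (fstMarginal r) (sndMarginal r)) hr.1
    (prodLaw_mem (fstMarginal_mem hr) (sndMarginal_mem hr)).1
    (fun z hz => by
      rcases mul_eq_zero.1 hz with h | h
      · exact le_antisymm (h ▸ le_fstMarginal hr.1 z.1 z.2) (hr.1 z)
      · exact le_antisymm (h ▸ le_sndMarginal hr.1 z.1 z.2) (hr.1 z))
    (by rw [(prodLaw_mem (fstMarginal_mem hr) (sndMarginal_mem hr)).2, hr.2])
  refine hg.trans_eq (sum_congr rfl fun z _ => ?_)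
  rcases (hr.1 z).eq_or_lt with h | h
  · simp [← h]
  · rw [prodLaw, log_mul (h.trans_le (le_fstMarginal hr.1 z.1 z.2)).ne'
      (h.trans_le (le_sndMarginal hr.1 z.1 z.2)).ne', sub_sub]

lemma margXU_mem {X Y U : Type*} [Fintype X] [Fintype Y] [Fintype U] {t : (X × Y) × U → ℝ}
    (ht : t ∈ stdSimplex ℝ ((X × Y) × U)) : margXU t ∈ stdSimplex ℝ (X × U) :=
  ⟨margXU_nonneg ht.1, by
    rw [← sum_sndMarginal, sndMarginal_margXU, sum_sndMarginal, ht.2]⟩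

lemma condEntropy_mul_log_two {α β : Type*} [Fintype α] [Fintype β] {r : α × β → ℝ}
    (hr : ∀ z, 0 ≤ r z) : condEntropy r * log 2 = ent r - ent (fstMarginal r) := by
  have e : ∀ a b, r (a, b) * logb 2 (r (a, b) / fstMarginal r a) * log 2 =
      r (a, b) * log (r (a, b)) - r (a, b) * log (fstMarginal r a) := by
    intro a b
    rcases (hr (a, b)).eq_or_lt with h | h
    · simp [← h]
    · rw [logb, log_div h.ne' (h.trans_le (le_fstMarginal hr a b)).ne', mul_assoc,
        div_mul_cancel₀ _ log_two_pos.ne', mul_sub]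
  rw [condEntropy, neg_mul, sum_mul]
  simp only [sum_mul, e, sum_sub_distrib]
  rw [ent_eq_neg_sum, ent_eq_neg_sum, Fintype.sum_prod_type]
  simp only [fstMarginal, sum_mul]
  ring

lemma condEntropy_nonneg {α β : Type*} [Fintype α] [Fintype β] {r : α × β → ℝ}
    (hr : ∀ z, 0 ≤ r z) : 0 ≤ condEntropy r := by
  rw [condEntropy, neg_nonneg]
  refine sum_nonpos fun a _ => sum_nonpos fun b _ => mul_nonpos_of_nonneg_of_nonpos (hr _) ?_
  exact logb_nonpos one_lt_two (div_nonneg (hr _) (fstMarginal_nonneg hr a))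
    (div_le_one_of_le₀ (le_fstMarginal hr a b) (fstMarginal_nonneg hr a))

/-- The choice `U = Y`. -/
lemma exists_auxDists_snd {X Y : Type*} [Fintype X] [Fintype Y] {r : X × Y → ℝ}
    (hr : r ∈ stdSimplex ℝ (X × Y)) :
    ∃ t ∈ auxDists r Y, mutualInfo (margXU t) = mutualInfo r ∧
      mutualInfo t = mutualInfo r + condEntropy r := by
  classical
  let t : (X × Y) × Y → ℝ := fun z => if z.1.2 = z.2 then r z.1 else 0
  have ht0 : ∀ z, 0 ≤ t z := fun z => by
    simp only [t]; split_ifs; exacts [hr.1 _, le_rfl]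
  have hfst : fstMarginal t = r := by
    funext z
    simp [fstMarginal, t]
  have hXU : margXU t = r := by
    funext z
    simp [margXU, t]
  have hsnd : sndMarginal t = sndMarginal r := by rw [← sndMarginal_margXU, hXU]
  have hent : ent t = ent r := by
    rw [ent, Fintype.sum_prod_type]
    refine sum_congr rfl fun z _ => ?_
    rw [sum_eq_single z.2]
    · simp [t]
    · intro y _ hy
      simp [t, hy.symm]
    · simp
  refine ⟨t, ⟨⟨ht0, by rw [← sum_fstMarginal, hfst, hr.2]⟩, hfst, fun x y u => ?_⟩, by rw [hXU], ?_⟩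
  · rw [hXU, hsnd]
    by_cases h : y = u
    · subst h
      simp [t, margYU, sndMarginal]
    · simp [t, margYU, h]
  · refine mul_right_cancel₀ log_two_pos.ne' ?_
    rw [add_mul, mutualInfo_mul_log_two_eq_ent ht0, mutualInfo_mul_log_two_eq_ent hr.1,
      condEntropy_mul_log_two hr.1, hfst, hsnd, hent]
    ring

section region

variable {X Y : Type*} [Fintype X] [Fintype Y] {p : X → ℝ} {q : X → Y → ℝ}

theorem simulationRateRegion_eq_rateSet (hp : p ∈ stdSimplex ℝ X)
    (hq : ∀ x, q x ∈ stdSimplex ℝ Y) : simulationRateRegion p q = rateSet p q := by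
  refine Set.Subset.antisymm
    (closure_minimal (achievable_subset_rateSet hp hq) (isClosed_rateSet p q)) ?_
  rintro ⟨R₁, R₂⟩ ⟨h2, m, -, t, ht, hI1, hI2⟩
  dsimp only at h2 hI1 hI2
  have h1 : 0 ≤ R₁ := (mutualInfo_nonneg (margXU_mem ht.1)).trans hI1
  -- Raising `R₁` slightly makes both information constraints strict; closure absorbs the excess.
  have hlim : Filter.Tendsto (fun n : ℕ => (R₁ + 1 / ((n : ℝ) + 1), R₂)) Filter.atTop
      (nhds (R₁, R₂)) := by
    have := tendsto_one_div_add_atTop_nhds_zero_nat (𝕜 := ℝ) |>.const_add R₁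
    rw [add_zero] at this
    exact this.prodMk_nhds tendsto_const_nhds
  refine mem_closure_of_tendsto hlim (Filter.Eventually.of_forall fun n => ?_)
  have hn : (0 : ℝ) < 1 / ((n : ℝ) + 1) := Nat.one_div_pos_of_nat
  exact achievable_of_auxDists hq (by linarith) h2 ht (by linarith) (by linarith)

/-- Data processing makes the bound on `I(X;U)` redundant at `R₂ = 0`. The infimum is attained
because the region is closed; `U = Y` shows that it is taken over a nonempty set. -/
lemma isLeast_commonInfo (hp : p ∈ stdSimplex ℝ X) (hq : ∀ x, q x ∈ stdSimplex ℝ Y) :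
    IsLeast {R₁ : ℝ | (R₁, (0 : ℝ)) ∈ rateSet p q} (commonInfo (jointDist p q)) := by
  constructor
  · have hclosed : IsClosed {R₁ : ℝ | (R₁, (0 : ℝ)) ∈ rateSet p q} :=
      (isClosed_rateSet p q).preimage (by fun_prop : Continuous fun R₁ : ℝ => (R₁, (0 : ℝ)))
    obtain ⟨t, ht, -⟩ := exists_auxDists_snd (jointDist_mem hp hq)
    obtain ⟨t', ht', -⟩ := exists_auxDists_card_le ht
    refine hclosed.closure_subset_iff.2 ?_ (csInf_mem_closure ⟨_, _, t', ht', rfl⟩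
      ⟨0, ?_⟩)
    · rintro c ⟨m, t, ht, rfl⟩
      exact mem_rateSet_of_auxDists le_rfl ht (mutualInfo_margXU_le ht.1.1) (by simp)
    · rintro c ⟨m, t, ht, rfl⟩
      exact mutualInfo_nonneg ht.1
  · rintro R₁ ⟨-, m, -, t, ht, -, hI⟩
    rw [add_zero] at hI
    have h : commonInfo (jointDist p q) ≤ mutualInfo t := by
      refine csInf_le ⟨0, ?_⟩ ⟨m, t, ht, rfl⟩
      rintro c ⟨m, t, ht, rfl⟩
      exact mutualInfo_nonneg ht.1
    exact h.trans hI

lemma mutualInfo_le_of_mem_rateSet {R : ℝ × ℝ} (hR : R ∈ rateSet p q) :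
    mutualInfo (jointDist p q) ≤ R.1 := by
  obtain ⟨-, m, -, t, ht, hI, -⟩ := hR
  exact (mutualInfo_le_mutualInfo_margXU ht).trans hI

lemma mem_rateSet_of_condEntropy_le (hp : p ∈ stdSimplex ℝ X) (hq : ∀ x, q x ∈ stdSimplex ℝ Y)
    {R₂ : ℝ} (hR : condEntropy (jointDist p q) ≤ R₂) :
    (mutualInfo (jointDist p q), R₂) ∈ rateSet p q := by
  have hr := jointDist_mem hp hq
  obtain ⟨t, ht, h1, h2⟩ := exists_auxDists_snd hr
  exact mem_rateSet_of_auxDists ((condEntropy_nonneg hr.1).trans hR) ht h1.le (by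
    rw [h2]
    exact add_le_add_right hR _)

end region

end ChannelSimulation

end

theorem theorem1 {X Y : Type*} [Fintype X] [Fintype Y]
    (p : X → ℝ) (hp : p ∈ stdSimplex ℝ X)
    (q : X → Y → ℝ) (hq : ∀ x, q x ∈ stdSimplex ℝ Y) :
    ChannelSimulation.simulationRateRegion p q = ChannelSimulation.rateSet p q ∧
    IsLeast {R₁ : ℝ | (R₁, (0 : ℝ)) ∈ ChannelSimulation.simulationRateRegion p q}
      (ChannelSimulation.commonInfo (ChannelSimulation.jointDist p q)) ∧
    (∀ R ∈ ChannelSimulation.simulationRateRegion p q,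
      ChannelSimulation.mutualInfo (ChannelSimulation.jointDist p q) ≤ R.1) ∧
    (∀ R₂ : ℝ, ChannelSimulation.condEntropy (ChannelSimulation.jointDist p q) ≤ R₂ →
      IsLeast {R₁ : ℝ | (R₁, R₂) ∈ ChannelSimulation.simulationRateRegion p q}
        (ChannelSimulation.mutualInfo (ChannelSimulation.jointDist p q))) := by
  rw [ChannelSimulation.simulationRateRegion_eq_rateSet hp hq]
  exact ⟨rfl, ChannelSimulation.isLeast_commonInfo hp hq,
    fun R hR => ChannelSimulation.mutualInfo_le_of_mem_rateSet hR,
    fun R₂ hR₂ => ⟨ChannelSimulation.mem_rateSet_of_condEntropy_le hp hq hR₂,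
      fun R₁ hR₁ => ChannelSimulation.mutualInfo_le_of_mem_rateSet hR₁⟩⟩
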